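/- Let $\Delta=\{(x,y)\in\mathbb R^2:\ x,\,y,\,1-x-y\ge 0\}$, let $\mathbf G=\sum_{n\ge 0}(-1)^n/(2n+1)^2$ be the Catalan constant, and for an integer $m\ge 0$ let $L_m=\operatorname{lcm}(1,\dots,m)$ (so $L_0=1$). Let $F\in\mathbb Z[x,y]$ be invariant under the automorphism $\sigma$ of $\mathbb Z[x,y]$ with $(x,y)\mapsto(-y,x)$, and let $N$ be the total degree of $F$ (with $N=0$ if $F=0$). Then $N$ is even, the function $F/(1-x^2-y^2)$ is absolutely integrable on $\Delta$, and $$\int_\Delta \frac{F\,dx\,dy}{1-x^2-y^2}=a_F+b_F\,\mathbf G$$ with rational numbers $a_F,b_F$ such that $2^N b_F$ and $2^{N+3}L_N L_{N/2}\,a_F$ are integers, and which are given explicitly as follows. (1) $b_F$ is the constant term of the Laurent polynomial in $z$ obtained from $F\big(\tfrac{z+w}{2},\tfrac{z-w}{2i}\big)$ by setting $w=z^{-1}$. (2) Let $F_+$ be the sum of those terms of $F$ whose monomial $x^my^n$ has $m$ and $n$ both even, and write $F_+\big(\tfrac{z+w}{2},\tfrac{z-w}{2i}\big)=\sum_{k,l}\lambda_{k,l}z^kw^l$.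 Then $$a_F=\sum_{\substack{k>l\ge 0\\ k\equiv l\ (\mathrm{mod}\ 4)}}\frac{\lambda_{k,l}}{2(k-l)}\int_0^1 \frac{i\,f_{k,l}(1-y,y)\,(2y-1)}{y(1-y)}\,dy\;-\;\sum_{k>0}\frac{\lambda_{k,k}}{2}\int_0^1\sum_{j=0}^{k-1}\frac{(2y^2-2y+1)^j}{j+1}\,dy,$$ where $f_{k,l}(x,y)=(x+iy)^k(x-iy)^l-(x+iy)^l(x-iy)^k$; for all integers $k>l\ge 0$ with $k\equiv l\pmod 4$, the integrand $i f_{k,l}(1-y,y)(2y-1)/(y(1-y))$ is a polynomial in $y$ with integer coefficients, of degree at most $k+l-1$. -/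

import Mathlib

noncomputable section

namespace CatalanForms

open MvPolynomial

/-- The Catalan constant `1 - 1/3^2 + 1/5^2 - 1/7^2 + ⋯` (an absolutely convergent series). -/
def catalanG : ℝ := ∑' n : ℕ, (-1 : ℝ) ^ n / (2 * (n : ℝ) + 1) ^ 2

/-- The simplex `x, y, 1 - x - y ≥ 0` in the plane. -/
def simplexΔ : Set (ℝ × ℝ) := {p | 0 ≤ p.1 ∧ 0 ≤ p.2 ∧ 0 ≤ 1 - p.1 - p.2}

/-- The substitution `(x, y) ↦ (-y, x)` on `ℤ[x, y]`; `X 0` is `x` and `X 1` is `y`. -/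
def sigma : MvPolynomial (Fin 2) ℤ →ₐ[ℤ] MvPolynomial (Fin 2) ℤ :=
  aeval ![-X 1, X 0]

/-- The function `F / (1 - x^2 - y^2)` on the plane. -/
def simplePoleFun (F : MvPolynomial (Fin 2) ℤ) (p : ℝ × ℝ) : ℝ :=
  aeval ![p.1, p.2] F / (1 - p.1 ^ 2 - p.2 ^ 2)

/-- `L_m`, the least common multiple of `1, …, m` (so `L_0 = 1`). -/
def lcmUpTo (m : ℕ) : ℕ := (Finset.Icc 1 m).lcm id

/-- The polynomial `F((z + w)/2, (z - w)/(2i))`; here `X 0` is `z` and `X 1` is `w`. -/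
def zwForm (F : MvPolynomial (Fin 2) ℤ) : MvPolynomial (Fin 2) ℂ :=
  aeval ![C (1 / 2) * (X 0 + X 1), C (1 / (2 * Complex.I)) * (X 0 - X 1)] F

/-- The coefficient of `z^k w^l` in `F((z + w)/2, (z - w)/(2i))`. -/
def zwCoeff (F : MvPolynomial (Fin 2) ℤ) (k l : ℕ) : ℂ :=
  (zwForm F).coeff (Finsupp.single 0 k + Finsupp.single 1 l)

/-- The Laurent polynomial in `z` obtained from `F((z + w)/2, (z - w)/(2i))` by `w = z⁻¹`. -/
def restrictToCircle (F : MvPolynomial (Fin 2) ℤ) : LaurentPolynomial ℂ :=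
  aeval ![LaurentPolynomial.T 1, LaurentPolynomial.T (-1)] (zwForm F)

/-- The part of `F` made of the monomials `x^m y^n` with `m` and `n` both even. -/
def evenPart (F : MvPolynomial (Fin 2) ℤ) : MvPolynomial (Fin 2) ℤ :=
  ∑ d ∈ F.support with Even (d 0) ∧ Even (d 1), monomial d (F.coeff d)

/-- `f_{k,l}(x, y) = (x + iy)^k (x - iy)^l - (x + iy)^l (x - iy)^k`. -/
def fPoly (k l : ℕ) (x y : ℂ) : ℂ :=
  (x + Complex.I * y) ^ k * (x - Complex.I * y) ^ l
    - (x + Complex.I * y) ^ l * (x - Complex.I * y) ^ k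

/-- `i f_{k,l}(1 - y, y) (2y - 1) / (y (1 - y))`. -/
def firstIntegrand (k l : ℕ) (y : ℝ) : ℂ :=
  Complex.I * fPoly k l (1 - (y : ℂ)) y * (2 * (y : ℂ) - 1) / ((y : ℂ) * (1 - (y : ℂ)))

/-- The one-variable integral attached to `z^k w^l + z^l w^k`, for `k > l`. -/
def firstIntegral (k l : ℕ) : ℂ :=
  1 / (2 * ((k : ℂ) - (l : ℂ))) * ∫ y in (0 : ℝ)..1, firstIntegrand k l y

/-- The one-variable integral attached to `z^k w^k - 1`, for `k > 0`. -/
def secondIntegral (k : ℕ) : ℝ :=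
  -(1 / 2) * ∫ y in (0 : ℝ)..1,
    ∑ j ∈ Finset.range k, 1 / ((j : ℝ) + 1) * (2 * y ^ 2 - 2 * y + 1) ^ j

/-- For `H` of degree at most `N`, with coefficients `λ_{k,l}` in `z, w`: the sum of
`λ_{k,l} * firstIntegral k l` over `k > l ≥ 0`, `k ≡ l (mod 4)`, plus the sum of
`λ_{k,k} * secondIntegral k` over `k > 0` (only `k + l ≤ N` can contribute). -/
def coeffOfOne (H : MvPolynomial (Fin 2) ℤ) (N : ℕ) : ℂ :=
  (∑ k ∈ Finset.range (N + 1), ∑ l ∈ Finset.range k with k ≡ l [MOD 4],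
      zwCoeff H k l * firstIntegral k l)
    + ∑ k ∈ Finset.Icc 1 N, zwCoeff H k k * (secondIntegral k : ℂ)

end CatalanForms

end

/-! Put z = x + iy and w = x - iy, so that zw = x² + y². Under `sigma`, z becomes iz and w becomes
-iw, so invariance leaves only the terms z^k w^l with k ≡ l (mod 4). The simplex is symmetric under
(x, y) ↦ (y, x), and F(y, x) = F(x, -y). Hence F has the same integral as its average with F(x, -y),
which is F_+, and the coefficients of F_+ are symmetric in k and l. It remains to integrate z^k w^l
+ z^l w^k for k > l, and z^k w^k.

In the coordinates (t(1 - y), ty) the pole becomes 1 - t²q with q = 2y² - 2y + 1, and q is the value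
of zw on the edge x + y = 1. A geometric expansion followed by integration in t gives a series with
weights 1/(k + l + 2m + 2) (`hasSum_coneIntegral`). For k > l, integration by parts along the edge
cancels each weight, with no boundary term because k ≡ l (mod 4). The series is then geometric again
and sums to the one-variable polynomial integral (`integral_zwEdge_add`, `coneIntegral_zwEdge_add`).
For k = l the series is a tail of the one for F = 1, and the missing terms give `secondIntegral`
(`coneIntegral_zwEdge_self`). The case F = 1 gives the Catalan constant (`coneIntegral_zero_one`),
so its multiplier is the sum of the diagonal coefficients.

For the denominators: 2^N clears the coefficients of F_+, L_N clears the integrals of integer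
polynomials of degree less than N, and 8 L_{N/2} clears the outside factors 1/(2(k - l)) and 1/(2(j
+ 1)). -/

noncomputable section

namespace CatalanForms

/-! ### Coefficients in z and w: symmetries, degree bounds, denominators. -/

section LaurentCoefficients

open MvPolynomial

/-- The substitution `X i ↦ c i * X i`. -/
def scaleVars {R : Type*} [CommRing R] (c : Fin 2 → R) :
    MvPolynomial (Fin 2) R →ₐ[R] MvPolynomial (Fin 2) R :=
  aeval fun i => C (c i) * X i

theorem coeff_scaleVars {R : Type*} [CommRing R] (c : Fin 2 → R) (P : MvPolynomial (Fin 2) R)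
    (d : Fin 2 →₀ ℕ) :
    (scaleVars c P).coeff d = c 0 ^ d 0 * c 1 ^ d 1 * P.coeff d := by
  induction P using MvPolynomial.induction_on' with
  | add p q hp hq => simp [hp, hq, mul_add]
  | monomial e a =>
    have h : scaleVars c (monomial e a) = monomial e (c 0 ^ e 0 * c 1 ^ e 1 * a) := by
      rw [scaleVars, aeval_monomial, Finsupp.prod_fintype _ _ (by simp), Fin.prod_univ_two,
        monomial_eq (s := e), Finsupp.prod_fintype _ _ (by simp), Fin.prod_univ_two]
      simp only [mul_pow, map_mul, map_pow, algebraMap_eq]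
      ring
    rw [h, coeff_monomial, coeff_monomial]
    split_ifs with hd
    · rw [hd]
    · simp

/-- The substitution `(x, y) ↦ (x, -y)`. -/
def conjY : MvPolynomial (Fin 2) ℤ →ₐ[ℤ] MvPolynomial (Fin 2) ℤ := scaleVars ![1, -1]

theorem sigma_sigma (F : MvPolynomial (Fin 2) ℤ) :
    sigma (sigma F) = scaleVars ![-1, -1] F := by
  have h : sigma.comp sigma = scaleVars ![-1, -1] := by
    ext i : 1
    fin_cases i <;> simp [sigma, scaleVars]
  exact DFunLike.congr_fun h F

/-- The square of `sigma` is (x, y) ↦ (-x, -y), which multiplies a monomial by the parity sign of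
its degree. -/
theorem even_degree_of_coeff_ne_zero {F : MvPolynomial (Fin 2) ℤ} (hF : sigma F = F)
    {d : Fin 2 →₀ ℕ} (hd : F.coeff d ≠ 0) : Even (d 0 + d 1) := by
  have h : (scaleVars ![-1, -1] F).coeff d = F.coeff d := by
    rw [← sigma_sigma, hF, hF]
  rw [coeff_scaleVars] at h
  by_contra hodd
  rw [Nat.not_even_iff_odd] at hodd
  simp only [Matrix.cons_val_zero, Matrix.cons_val_one, ← pow_add, hodd.neg_one_pow] at h
  omega

theorem even_totalDegree {F : MvPolynomial (Fin 2) ℤ} (hF : sigma F = F) :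
    Even F.totalDegree := by
  by_cases h0 : F = 0
  · simp [h0]
  obtain ⟨d, hd, h⟩ := F.support.exists_mem_eq_sup (support_nonempty.2 h0)
    fun s => s.sum fun _ e => e
  rw [totalDegree, h, Finsupp.sum_fintype _ _ (by simp), Fin.sum_univ_two]
  exact even_degree_of_coeff_ne_zero hF (mem_support_iff.1 hd)

theorem coeff_evenPart (F : MvPolynomial (Fin 2) ℤ) (d : Fin 2 →₀ ℕ) :
    (evenPart F).coeff d = if Even (d 0) ∧ Even (d 1) then F.coeff d else 0 := by
  classical
  rw [evenPart, coeff_sum]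
  simp only [coeff_monomial, Finset.sum_ite_eq', Finset.mem_filter, mem_support_iff]
  by_cases h : F.coeff d = 0 <;> simp [h]

/-- All degrees are even, so the two exponents have equal parity, and the sign change of y detects
that parity. -/
theorem two_mul_evenPart {F : MvPolynomial (Fin 2) ℤ} (hF : sigma F = F) :
    2 * evenPart F = F + conjY F := by
  ext d
  have h2 : (2 : MvPolynomial (Fin 2) ℤ) = C 2 := by simp
  rw [h2, coeff_C_mul, coeff_evenPart, coeff_add, conjY, coeff_scaleVars]
  by_cases hd : F.coeff d = 0
  · simp [hd]
  have he := even_degree_of_coeff_ne_zero hF hd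
  rw [Nat.even_add] at he
  by_cases h1 : Even (d 1)
  · rw [if_pos ⟨he.2 h1, h1⟩]
    simp [h1.neg_one_pow, two_mul]
  · rw [if_neg fun h => h1 h.2]
    simp [(Nat.not_even_iff_odd.1 h1).neg_one_pow]

theorem evenPart_totalDegree_le (F : MvPolynomial (Fin 2) ℤ) :
    (evenPart F).totalDegree ≤ F.totalDegree := by
  apply Finset.sup_mono
  intro d hd
  rw [mem_support_iff, coeff_evenPart] at hd
  rw [mem_support_iff]
  intro h
  simp [h] at hd

/-- `zwForm` as an algebra homomorphism. -/
def zwHom : MvPolynomial (Fin 2) ℤ →ₐ[ℤ] MvPolynomial (Fin 2) ℂ :=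
  aeval ![C (1 / 2) * (X 0 + X 1), C (1 / (2 * Complex.I)) * (X 0 - X 1)]

theorem zwForm_eq_zwHom (F : MvPolynomial (Fin 2) ℤ) : zwForm F = zwHom F := rfl

theorem zwHom_conjY (F : MvPolynomial (Fin 2) ℤ) :
    zwHom (conjY F) = rename (Equiv.swap (0 : Fin 2) 1) (zwHom F) := by
  have h : zwHom.comp conjY =
      ((rename (Equiv.swap (0 : Fin 2) 1)).restrictScalars ℤ).comp zwHom := by
    ext i : 1
    fin_cases i
    · simp [conjY, scaleVars, zwHom, add_comm]
    · simp [conjY, scaleVars, zwHom]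
      ring
  exact DFunLike.congr_fun h F

theorem zwHom_sigma (F : MvPolynomial (Fin 2) ℤ) :
    zwHom (sigma F) = scaleVars ![Complex.I, -Complex.I] (zwHom F) := by
  have h : zwHom.comp sigma =
      ((scaleVars ![Complex.I, -Complex.I]).restrictScalars ℤ).comp zwHom := by
    have h1 : (1 / 2 : ℂ) = 1 / (2 * Complex.I) * Complex.I := by field_simp
    have h2 : 1 / (2 * Complex.I) = -(1 / 2 * Complex.I) := by
      field_simp
      rw [Complex.I_sq, neg_neg]
    have e : (C (1 / 2 : ℂ) : MvPolynomial (Fin 2) ℂ) = C (1 / (2 * Complex.I)) * C Complex.I := by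
      rw [← C_mul, ← h1]
    have e' : (C (1 / (2 * Complex.I)) : MvPolynomial (Fin 2) ℂ) = -(C (1 / 2 : ℂ) * C Complex.I) := by
      rw [← C_mul, ← C_neg, ← h2]
    ext i : 1
    fin_cases i
    · simp only [zwHom, sigma, scaleVars, AlgHom.comp_apply, aeval_X, AlgHom.restrictScalars_apply,
        Fin.zero_eta, Matrix.cons_val_zero, Matrix.cons_val_one, map_mul, map_add, map_neg, aeval_C,
        algebraMap_eq]
      rw [e']
      ring
    · simp only [zwHom, sigma, scaleVars, AlgHom.comp_apply, aeval_X, AlgHom.restrictScalars_apply,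
        Fin.mk_one, Matrix.cons_val_zero, Matrix.cons_val_one, map_mul, map_sub, map_neg, aeval_C,
        algebraMap_eq]
      rw [e]
      ring
  exact DFunLike.congr_fun h F

theorem zwCoeff_conjY (F : MvPolynomial (Fin 2) ℤ) (k l : ℕ) :
    zwCoeff (conjY F) k l = zwCoeff F l k := by
  have h := coeff_rename_mapDomain (Equiv.swap (0 : Fin 2) 1) (Equiv.injective _) (zwHom F)
    (Finsupp.single 0 l + Finsupp.single 1 k)
  rw [Finsupp.mapDomain_add, Finsupp.mapDomain_single, Finsupp.mapDomain_single,
    Equiv.swap_apply_left, Equiv.swap_apply_right, ← zwHom_conjY, add_comm] at h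
  exact h

theorem two_mul_zwCoeff_evenPart {F : MvPolynomial (Fin 2) ℤ} (hF : sigma F = F) (k l : ℕ) :
    2 * zwCoeff (evenPart F) k l = zwCoeff F k l + zwCoeff F l k := by
  have h := congrArg (fun P => (zwHom P).coeff (Finsupp.single 0 k + Finsupp.single 1 l))
    (two_mul_evenPart hF)
  rw [two_mul] at h
  simp only [map_add, coeff_add] at h
  rw [← zwCoeff_conjY F k l, two_mul]
  exact h

/-- The monomial z^k w^l is an eigenvector of `sigma` with eigenvalue i^k (-i)^l = i^(k-l), which is
1 only when k ≡ l (mod 4). -/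
theorem zwCoeff_eq_zero_of_not_modEq {F : MvPolynomial (Fin 2) ℤ} (hF : sigma F = F) {k l : ℕ}
    (hkl : ¬ k ≡ l [MOD 4]) : zwCoeff F k l = 0 := by
  have h : zwCoeff F k l = Complex.I ^ k * (-Complex.I) ^ l * zwCoeff F k l := by
    have h := coeff_scaleVars ![Complex.I, -Complex.I] (zwHom F)
      (Finsupp.single 0 k + Finsupp.single 1 l)
    rw [← zwHom_sigma, hF] at h
    simpa [zwCoeff, zwForm_eq_zwHom] using h
  by_contra h0
  have h1 : Complex.I ^ k * (-Complex.I) ^ l = 1 := by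
    apply mul_right_cancel₀ h0
    rw [one_mul, ← h]
  have h2 : Complex.I ^ k = Complex.I ^ l := by
    calc Complex.I ^ k = Complex.I ^ k * (-Complex.I * Complex.I) ^ l := by simp
      _ = Complex.I ^ k * (-Complex.I) ^ l * Complex.I ^ l := by rw [mul_pow, mul_assoc]
      _ = Complex.I ^ l := by rw [h1, one_mul]
  apply hkl
  rw [Complex.I_pow_eq_pow_mod k, Complex.I_pow_eq_pow_mod l] at h2
  have hk := Nat.mod_lt k (show 4 > 0 by norm_num)
  have hl := Nat.mod_lt l (show 4 > 0 by norm_num)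
  rw [Nat.ModEq]
  generalize k % 4 = a at *
  generalize l % 4 = b at *
  interval_cases a <;> interval_cases b <;>
    first | rfl | (norm_num [Complex.ext_iff, pow_succ] at h2)

theorem zwForm_monomial (d : Fin 2 →₀ ℕ) (c : ℤ) :
    zwForm (monomial d c) = C (c * (1 / 2) ^ d 0 * (1 / (2 * Complex.I)) ^ d 1) *
      map (Int.castRingHom ℂ) ((X 0 + X 1) ^ d 0 * (X 0 - X 1) ^ d 1) := by
  rw [zwForm, aeval_monomial, Finsupp.prod_fintype _ _ (by simp), Fin.prod_univ_two]
  simp only [Matrix.cons_val_zero, Matrix.cons_val_one, mul_pow, map_mul, map_pow, map_add, map_sub,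
    map_X, eq_intCast, map_intCast]
  ring

theorem degree_le_totalDegree {R : Type*} [CommRing R] {F : MvPolynomial (Fin 2) R}
    {d : Fin 2 →₀ ℕ} (hd : d ∈ F.support) : d 0 + d 1 ≤ F.totalDegree := by
  have := le_totalDegree hd
  rwa [Finsupp.sum_fintype _ _ (by simp), Fin.sum_univ_two] at this

theorem totalDegree_zwForm_le (F : MvPolynomial (Fin 2) ℤ) :
    (zwForm F).totalDegree ≤ F.totalDegree := by
  rw [zwForm_eq_zwHom]
  conv_lhs => rw [F.as_sum, map_sum]
  apply (totalDegree_finsetSum _ _).trans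
  apply Finset.sup_le
  intro d hd
  rw [← zwForm_eq_zwHom, zwForm_monomial]
  refine (totalDegree_mul _ _).trans ?_
  rw [totalDegree_C, zero_add]
  have h1 : (X 0 + X 1 : MvPolynomial (Fin 2) ℂ).totalDegree ≤ 1 :=
    (totalDegree_add _ _).trans (by simp)
  have h2 : (X 0 - X 1 : MvPolynomial (Fin 2) ℂ).totalDegree ≤ 1 :=
    (totalDegree_sub _ _).trans (by simp)
  simp only [map_mul, map_pow, map_add, map_sub, map_X]
  calc _ ≤ d 0 * 1 + d 1 * 1 := (totalDegree_mul _ _).trans (add_le_add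
          ((totalDegree_pow _ _).trans (Nat.mul_le_mul_left _ h1))
          ((totalDegree_pow _ _).trans (Nat.mul_le_mul_left _ h2)))
    _ ≤ _ := by simpa using degree_le_totalDegree hd

theorem zwCoeff_eq_zero_of_lt {F : MvPolynomial (Fin 2) ℤ} {k l : ℕ}
    (h : F.totalDegree < k + l) : zwCoeff F k l = 0 := by
  by_contra h0
  have := degree_le_totalDegree (mem_support_iff.2 h0)
  have := totalDegree_zwForm_le F
  simp at *
  omega

/-- The even exponent of y is essential: it turns the power of 1/(2i) into a sign times a power of
1/2, so no factor i survives. -/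
theorem exists_int_two_pow_mul_zwCoeff_evenPart (F : MvPolynomial (Fin 2) ℤ) (k l : ℕ) :
    ∃ m : ℤ, (2 : ℂ) ^ F.totalDegree * zwCoeff (evenPart F) k l = m := by
  suffices h : (2 : ℂ) ^ F.totalDegree * zwCoeff (evenPart F) k l ∈ (Int.castRingHom ℂ).range by
    obtain ⟨m, hm⟩ := h
    exact ⟨m, hm.symm⟩
  rw [zwCoeff, evenPart, zwForm_eq_zwHom, map_sum, coeff_sum, Finset.mul_sum]
  refine Subring.sum_mem _ fun d hd => ?_
  rw [Finset.mem_filter] at hd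
  obtain ⟨hd, ⟨r, hr⟩, s, hs⟩ := hd
  rw [← zwForm_eq_zwHom, zwForm_monomial, coeff_C_mul, coeff_map, ← mul_assoc]
  refine Subring.mul_mem _ ?_ ⟨_, rfl⟩
  obtain ⟨t, ht⟩ := Nat.exists_eq_add_of_le (degree_le_totalDegree hd)
  refine ⟨2 ^ t * F.coeff d * (-1) ^ s, ?_⟩
  have hI : (Complex.I ^ d 1)⁻¹ = (-1 : ℂ) ^ s := by
    rw [hs, ← two_mul, pow_mul, Complex.I_sq, ← inv_pow, inv_neg, inv_one]
  rw [ht]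
  simp only [one_div, mul_inv, mul_pow, inv_pow, pow_add, map_mul, map_pow, hI]
  simp
  field_simp

theorem eval_zwForm (F : MvPolynomial (Fin 2) ℤ) (x y : ℝ) :
    aeval ![(x : ℂ) + Complex.I * y, (x : ℂ) - Complex.I * y] (zwForm F) =
      ((aeval ![x, y] F : ℝ) : ℂ) := by
  have h : ((aeval ![(x : ℂ) + Complex.I * y, (x : ℂ) - Complex.I * y]).restrictScalars ℤ).comp zwHom
      = (Complex.ofRealAm.restrictScalars ℤ).comp (aeval ![x, y]) := by
    ext i : 1
    fin_cases i
    · simp [zwHom]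
      ring
    · simp [zwHom]
      field_simp
      ring_nf
      simp
  exact DFunLike.congr_fun h F

/-- Replaces the support by a square of exponents containing it, so that evaluation and restriction
to the circle are both sums over `zwCoeff`. -/
theorem sum_eq_sum_range {M : Type*} [AddCommMonoid M] {P : MvPolynomial (Fin 2) ℂ} {N : ℕ}
    (hN : P.totalDegree ≤ N) (g : (Fin 2 →₀ ℕ) → ℂ → M) (hg : ∀ d, g d 0 = 0) :
    ∑ d ∈ P.support, g d (P.coeff d) =
      ∑ k ∈ Finset.range (N + 1), ∑ l ∈ Finset.range (N + 1),
        g (Finsupp.single 0 k + Finsupp.single 1 l)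
          (P.coeff (Finsupp.single 0 k + Finsupp.single 1 l)) := by
  rw [← Finset.sum_product']
  refine Finset.sum_of_injOn (fun d => (d 0, d 1)) ?_ ?_ ?_ ?_
  · intro d _ e _ h
    ext i
    fin_cases i
    · exact congrArg Prod.fst h
    · exact congrArg Prod.snd h
  · intro d hd
    have := degree_le_totalDegree hd
    simp only [Finset.coe_product, Set.mem_prod, Finset.mem_coe, Finset.mem_range]
    omega
  · rintro ⟨k, l⟩ _ h
    by_cases h0 : P.coeff (Finsupp.single 0 k + Finsupp.single 1 l) = 0
    · simp only [h0, hg]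
    · exact absurd ⟨_, mem_support_iff.2 h0, by simp⟩ h
  · intro d _
    have : (Finsupp.single 0 (d 0) + Finsupp.single 1 (d 1) : Fin 2 →₀ ℕ) = d := by
      ext i
      fin_cases i <;> simp
    simp only [this]

theorem aeval_eq_sum_zwCoeff (F : MvPolynomial (Fin 2) ℤ) {N : ℕ} (hN : F.totalDegree ≤ N)
    (x y : ℝ) :
    ((aeval ![x, y] F : ℝ) : ℂ) = ∑ k ∈ Finset.range (N + 1), ∑ l ∈ Finset.range (N + 1),
      zwCoeff F k l * (((x : ℂ) + Complex.I * y) ^ k * ((x : ℂ) - Complex.I * y) ^ l) := by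
  rw [← eval_zwForm, aeval_def, eval₂_eq',
    sum_eq_sum_range ((totalDegree_zwForm_le F).trans hN) (fun d c => algebraMap ℂ ℂ c *
      ∏ i, ![(x : ℂ) + Complex.I * y, (x : ℂ) - Complex.I * y] i ^ d i) (by simp)]
  simp [zwCoeff]

theorem coeff_restrictToCircle (F : MvPolynomial (Fin 2) ℤ) :
    (restrictToCircle F).coeff 0 = ∑ k ∈ Finset.range (F.totalDegree + 1), zwCoeff F k k := by
  have key : ∀ (c : ℂ) (k l : ℕ), (algebraMap ℂ (LaurentPolynomial ℂ) c *
      (LaurentPolynomial.T 1 ^ k * LaurentPolynomial.T (-1) ^ l)).coeff 0 =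
        if k = l then c else 0 := by
    intro c k l
    rw [LaurentPolynomial.T_pow, LaurentPolynomial.T_pow, ← LaurentPolynomial.T_add,
      ← LaurentPolynomial.C_eq_algebraMap, ← LaurentPolynomial.single_eq_C_mul_T,
      AddMonoidAlgebra.coeff_single, Finsupp.single_apply]
    simp only [show ((k : ℤ) * 1 + l * -1 = 0) = (k = l) by rw [eq_iff_iff]; omega]
  rw [restrictToCircle, aeval_def, eval₂_eq',
    sum_eq_sum_range (totalDegree_zwForm_le F) (fun d c => algebraMap ℂ (LaurentPolynomial ℂ) c *
      ∏ i, ![LaurentPolynomial.T 1, LaurentPolynomial.T (-1)] i ^ d i)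
      (fun d => by rw [map_zero, zero_mul]), AddMonoidAlgebra.coeff_sum, Finsupp.finsetSum_apply]
  refine Finset.sum_congr rfl fun k hk => ?_
  rw [AddMonoidAlgebra.coeff_sum, Finsupp.finsetSum_apply]
  simp only [Fin.prod_univ_two, Matrix.cons_val_zero, Matrix.cons_val_one, key]
  simp [zwCoeff]
  intro h
  exfalso
  rw [Finset.mem_range] at hk
  omega

end LaurentCoefficients

/-! ### Integer polynomials on the edge, and denominators of their integrals. -/

section EdgePolynomials

open Polynomial

/-- On the edge `(1 - y, y)`, a difference of powers `z ^ (4 * j + 4) - w ^ (4 * j + 4)` is divisible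
by `z ^ 4 - w ^ 4`, with a quotient which has integer coefficients in `y`. -/
theorem exists_pow_sub_pow_quotient (j : ℕ) : ∃ S : ℤ[X], S.natDegree ≤ 4 * j ∧ ∀ y : ℂ,
    (1 - y + Complex.I * y) ^ (4 * (j + 1)) - (1 - y - Complex.I * y) ^ (4 * (j + 1)) =
      8 * Complex.I * y * (1 - y) * (1 - 2 * y) * aeval y S := by
  induction j using Nat.twoStepInduction with
  | zero =>
    refine ⟨1, by simp, fun y => ?_⟩
    rw [map_one]
    linear_combination (8 * Complex.I * y ^ 3 * (1 - y)) * Complex.I_sq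
  | one =>
    refine ⟨2 * ((1 - X) ^ 4 - 6 * (1 - X) ^ 2 * X ^ 2 + X ^ 4), by compute_degree, fun y => ?_⟩
    simp only [map_mul, map_add, map_sub, map_pow, aeval_X, map_one, map_ofNat]
    have h4 : Complex.I ^ 4 = 1 := Complex.I_pow_four
    have h3 : Complex.I ^ 3 = -Complex.I := Complex.I_pow_three
    have h5 : Complex.I ^ 5 = Complex.I := by rw [pow_succ, h4, one_mul]
    have h7 : Complex.I ^ 7 = -Complex.I := by rw [show 7 = 4 + 3 by rfl, pow_add, h4, h3, one_mul]
    ring_nf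
    simp only [h3, h5, h7]
    ring
  | more j h0 h1 =>
    obtain ⟨S, hS, hSy⟩ := h0
    obtain ⟨T, hT, hTy⟩ := h1
    -- The recurrence for a^(4n) - b^(4n) has coefficients a⁴ + b⁴ and -(ab)⁴, both integer
    -- polynomials in y when a and b are z and w on the edge.
    refine ⟨2 * ((1 - X) ^ 4 - 6 * (1 - X) ^ 2 * X ^ 2 + X ^ 4) * T
      - (2 * X ^ 2 - 2 * X + 1) ^ 4 * S, ?_, fun y => ?_⟩
    · have hd1 : (2 * ((1 - X) ^ 4 - 6 * (1 - X) ^ 2 * X ^ 2 + X ^ 4) : ℤ[X]).natDegree ≤ 4 := by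
        compute_degree
      have hd2 : ((2 * X ^ 2 - 2 * X + 1) ^ 4 : ℤ[X]).natDegree ≤ 8 := by
        compute_degree
      refine (natDegree_sub_le_of_le (natDegree_mul_le_of_le hd1 hT)
        (natDegree_mul_le_of_le hd2 hS)).trans ?_
      omega
    · have hsum : (1 - y + Complex.I * y) ^ 4 + (1 - y - Complex.I * y) ^ 4 =
          2 * ((1 - y) ^ 4 - 6 * (1 - y) ^ 2 * y ^ 2 + y ^ 4) := by
        have h4 : Complex.I ^ 4 = 1 := Complex.I_pow_four
        ring_nf
        simp only [h4, Complex.I_sq]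
        ring
      have hprod : (1 - y + Complex.I * y) * (1 - y - Complex.I * y) = 2 * y ^ 2 - 2 * y + 1 := by
        linear_combination (-y ^ 2) * Complex.I_sq
      simp only [map_mul, map_add, map_sub, map_pow, aeval_X, map_one, map_ofNat]
      rw [← hsum, ← hprod]
      specialize hTy y
      specialize hSy y
      generalize 1 - y + Complex.I * y = a at *
      generalize 1 - y - Complex.I * y = b at *
      rw [show 4 * (j + 1 + 1) = 4 * j + 8 by ring] at hTy
      rw [show 4 * (j + 1) = 4 * j + 4 by ring] at hSy
      rw [show 4 * (j + 2 + 1) = 4 * j + 12 by ring]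
      linear_combination (a ^ 4 + b ^ 4) * hTy - (a * b) ^ 4 * hSy

theorem exists_firstIntegrand_eq (k l : ℕ) (hlk : l < k) (hkl : k ≡ l [MOD 4]) :
    ∃ p : ℤ[X], p.natDegree < k + l ∧
      ∀ y : ℝ, 0 < y → y < 1 → firstIntegrand k l y = aeval (y : ℂ) p := by
  obtain ⟨j, rfl⟩ : ∃ j, k = l + 4 * (j + 1) := by
    obtain ⟨c, hc⟩ := (Nat.modEq_iff_dvd' hlk.le).1 hkl.symm
    exact ⟨c - 1, by omega⟩
  obtain ⟨S, hS, hSy⟩ := exists_pow_sub_pow_quotient j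
  -- Here (zw)^l factors out of f, the denominator y(1 - y) cancels, and i · 8i · (1 - 2y)(2y - 1) =
  -- 8(2y - 1)². The degree is at most 2 + 2l + 4j, which is k + l - 2.
  refine ⟨8 * (2 * X - 1) ^ 2 * (2 * X ^ 2 - 2 * X + 1) ^ l * S, ?_, fun y h0 h1 => ?_⟩
  · have hd1 : (8 * (2 * X - 1) ^ 2 : ℤ[X]).natDegree ≤ 2 := by compute_degree
    have hd2 : (2 * X ^ 2 - 2 * X + 1 : ℤ[X]).natDegree ≤ 2 := by compute_degree
    refine (natDegree_mul_le_of_le (natDegree_mul_le_of_le hd1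
      (natDegree_pow_le_of_le l hd2)) hS).trans_lt ?_
    omega
  · have hy0 : (y : ℂ) ≠ 0 := by exact_mod_cast h0.ne'
    have hy1 : (1 - y : ℂ) ≠ 0 := by exact_mod_cast (sub_pos.2 h1).ne'
    have hprod : (1 - y + Complex.I * y) * (1 - y - Complex.I * y) =
        2 * (y : ℂ) ^ 2 - 2 * y + 1 := by
      linear_combination (-(y : ℂ) ^ 2) * Complex.I_sq
    have hf : fPoly (l + 4 * (j + 1)) l (1 - y) y =
        (2 * (y : ℂ) ^ 2 - 2 * y + 1) ^ l * (8 * Complex.I * y * (1 - y) * (1 - 2 * y) * aeval (y : ℂ) S) := by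
      rw [← hSy, ← hprod, fPoly, mul_pow, pow_add, pow_add]
      ring
    rw [firstIntegrand, hf, div_eq_iff (mul_ne_zero hy0 hy1)]
    simp only [map_mul, map_add, map_sub, map_pow, aeval_X, map_one, map_ofNat]
    linear_combination (8 * (2 * (y : ℂ) ^ 2 - 2 * y + 1) ^ l * y * (1 - y) * (1 - 2 * y) *
      aeval (y : ℂ) S * (2 * y - 1)) * Complex.I_sq

theorem dvd_lcmUpTo {m N : ℕ} (h0 : 0 < m) (hm : m ≤ N) : m ∣ lcmUpTo N :=
  Finset.dvd_lcm (f := id) (Finset.mem_Icc.2 ⟨h0, hm⟩)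

/-- The exact value of the integral of an integer polynomial over the unit interval. -/
def unitIntegral (p : ℤ[X]) : ℚ := ∑ i ∈ Finset.range (p.natDegree + 1), (p.coeff i : ℚ) / (i + 1)

theorem integral_aeval (p : ℤ[X]) : ∫ y in (0 : ℝ)..1, aeval y p = unitIntegral p := by
  simp only [aeval_eq_sum_range, unitIntegral]
  rw [intervalIntegral.integral_finsetSum fun i _ =>
    (by fun_prop : Continuous _).intervalIntegrable _ _]
  push_cast
  refine Finset.sum_congr rfl fun i _ => ?_
  simp [div_eq_mul_inv]

theorem exists_lcmUpTo_mul_unitIntegral {p : ℤ[X]} {N : ℕ} (h : p.natDegree < N) :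
    ∃ m : ℤ, (lcmUpTo N : ℚ) * unitIntegral p = m := by
  suffices h : (lcmUpTo N : ℚ) * unitIntegral p ∈ (Int.castRingHom ℚ).range by
    obtain ⟨m, hm⟩ := h
    exact ⟨m, hm.symm⟩
  rw [unitIntegral, Finset.mul_sum]
  refine Subring.sum_mem _ fun i hi => ?_
  rw [Finset.mem_range] at hi
  obtain ⟨c, hc⟩ := dvd_lcmUpTo (Nat.succ_pos i) (show i + 1 ≤ N by omega)
  refine ⟨p.coeff i * c, ?_⟩
  rw [hc]
  push_cast
  simp
  field_simp

theorem exists_rat_firstIntegral {k l N : ℕ} (hlk : l < k) (hkl : k ≡ l [MOD 4]) :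
    ∃ r : ℚ, firstIntegral k l = r ∧
      (k + l ≤ N → ∃ m : ℤ, 8 * (lcmUpTo N : ℚ) * lcmUpTo (N / 2) * r = m) := by
  obtain ⟨p, hp, hpy⟩ := exists_firstIntegrand_eq k l hlk hkl
  obtain ⟨j, rfl⟩ : ∃ j, k = l + 4 * (j + 1) := by
    obtain ⟨c, hc⟩ := (Nat.modEq_iff_dvd' hlk.le).1 hkl.symm
    exact ⟨c - 1, by omega⟩
  refine ⟨1 / (8 * (j + 1)) * unitIntegral p, ?_, fun hN => ?_⟩
  · have h : ∫ y in (0 : ℝ)..1, firstIntegrand (l + 4 * (j + 1)) l y = (unitIntegral p : ℂ) := by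
      -- At y = 0 and y = 1 the integrand is 0 by the convention for division by zero, so the
      -- comparison with p is made on the open interval.
      rw [← Complex.ofReal_ratCast, ← integral_aeval, ← intervalIntegral.integral_ofReal,
        intervalIntegral.integral_of_le zero_le_one, intervalIntegral.integral_of_le zero_le_one,
        MeasureTheory.integral_Ioc_eq_integral_Ioo, MeasureTheory.integral_Ioc_eq_integral_Ioo]
      refine MeasureTheory.setIntegral_congr_fun measurableSet_Ioo fun y hy => ?_
      simp only [hpy y hy.1 hy.2]
      exact (aeval_algebraMap_apply ℂ y p)
    rw [firstIntegral, h]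
    push_cast
    congr 1
    ring
  · obtain ⟨m, hm⟩ := exists_lcmUpTo_mul_unitIntegral (hp.trans_le hN)
    -- The outside factor is 1/(2(k - l)) = 1/(8(j + 1)), and 4(j + 1) = k - l ≤ N.
    obtain ⟨c, hc⟩ := dvd_lcmUpTo (Nat.succ_pos j) (show j + 1 ≤ N / 2 by omega)
    refine ⟨c * m, ?_⟩
    rw [hc]
    push_cast
    rw [← hm]
    field_simp

theorem exists_rat_secondIntegral (k N : ℕ) :
    ∃ r : ℚ, secondIntegral k = r ∧
      (k + k ≤ N → ∃ m : ℤ, 8 * (lcmUpTo N : ℚ) * lcmUpTo (N / 2) * r = m) := by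
  refine ⟨-(1 / 2) * ∑ j ∈ Finset.range k, 1 / ((j : ℚ) + 1) *
    unitIntegral ((2 * X ^ 2 - 2 * X + 1) ^ j), ?_, fun hN => ?_⟩
  · rw [secondIntegral, intervalIntegral.integral_finsetSum fun i _ =>
      (by fun_prop : Continuous _).intervalIntegrable _ _]
    push_cast
    congr 1
    refine Finset.sum_congr rfl fun j _ => ?_
    rw [intervalIntegral.integral_const_mul, ← integral_aeval]
    simp only [map_mul, map_add, map_sub, map_pow, aeval_X, map_one, map_ofNat]
  · suffices h : 8 * (lcmUpTo N : ℚ) * lcmUpTo (N / 2) * (-(1 / 2) * ∑ j ∈ Finset.range k,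
        1 / ((j : ℚ) + 1) * unitIntegral ((2 * X ^ 2 - 2 * X + 1) ^ j)) ∈
        (Int.castRingHom ℚ).range by
      obtain ⟨m, hm⟩ := h
      exact ⟨m, hm.symm⟩
    rw [← mul_assoc, Finset.mul_sum]
    refine Subring.sum_mem _ fun j hj => ?_
    rw [Finset.mem_range] at hj
    have hd2 : (2 * X ^ 2 - 2 * X + 1 : ℤ[X]).natDegree ≤ 2 := by compute_degree
    obtain ⟨m, hm⟩ := exists_lcmUpTo_mul_unitIntegral
      (show ((2 * X ^ 2 - 2 * X + 1 : ℤ[X]) ^ j).natDegree < N from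
        (natDegree_pow_le_of_le j hd2).trans_lt (by omega))
    obtain ⟨c, hc⟩ := dvd_lcmUpTo (Nat.succ_pos j) (show j + 1 ≤ N / 2 by omega)
    refine ⟨-4 * c * m, ?_⟩
    rw [hc]
    simp only [eq_intCast]
    push_cast
    rw [← hm]
    field_simp
    ring

end EdgePolynomials

/-! ### Cone coordinates, integrability, and the radial series. -/

section ConeCoordinates

open MeasureTheory Set

/-- The open unit square. -/
def unitSquare : Set (ℝ × ℝ) := Ioo 0 1 ×ˢ Ioo 0 1

/-- The value of `x ^ 2 + y ^ 2` at the point `(1 - y, y)`. -/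
def normSqEdge (y : ℝ) : ℝ := 2 * y ^ 2 - 2 * y + 1

/-- Projective coordinates on the simplex: the slope and the level of `x + y`. -/
def coneMap (p : ℝ × ℝ) : ℝ × ℝ := (p.2 * (1 - p.1), p.2 * p.1)

/-- The derivative of `coneMap`. -/
def coneMapDeriv (p : ℝ × ℝ) : ℝ × ℝ →L[ℝ] ℝ × ℝ :=
  LinearMap.toContinuousLinearMap
    (Matrix.toLin (Module.Basis.finTwoProd ℝ) (Module.Basis.finTwoProd ℝ)
      !![-p.2, 1 - p.1; p.2, p.1])

theorem measurableSet_unitSquare : MeasurableSet unitSquare :=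
  measurableSet_Ioo.prod measurableSet_Ioo

theorem hasFDerivAt_coneMap (p : ℝ × ℝ) : HasFDerivAt coneMap (coneMapDeriv p) p := by
  unfold coneMapDeriv
  rw [Matrix.toLin_finTwoProd_toContinuousLinearMap]
  have h1 : HasFDerivAt (fun q : ℝ × ℝ => q.1) (ContinuousLinearMap.fst ℝ ℝ ℝ) p := hasFDerivAt_fst
  have h2 : HasFDerivAt (fun q : ℝ × ℝ => q.2) (ContinuousLinearMap.snd ℝ ℝ ℝ) p := hasFDerivAt_snd
  refine ((h2.mul (h1.const_sub 1)).prodMk (h2.mul h1)).congr_fderiv ?_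
  ext <;> simp

theorem abs_det_coneMapDeriv {p : ℝ × ℝ} (hp : p ∈ unitSquare) :
    |(coneMapDeriv p).det| = p.2 := by
  have h : (coneMapDeriv p).det = -p.2 := by
    unfold coneMapDeriv
    simp only [LinearMap.det_toContinuousLinearMap, LinearMap.det_toLin, Matrix.det_fin_two_of]
    ring
  rw [h, abs_neg, abs_of_pos hp.2.1]

theorem injOn_coneMap : InjOn coneMap unitSquare := by
  rintro ⟨y, t⟩ h ⟨y', t'⟩ _ he
  have ht : 0 < t := h.2.1
  simp only [coneMap, Prod.mk.injEq] at he
  obtain rfl : t = t' := by linarith [he.1, he.2]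
  simpa [ht.ne'] using he.2

theorem image_coneMap :
    coneMap '' unitSquare = {p | 0 < p.1 ∧ 0 < p.2 ∧ p.1 + p.2 < 1} := by
  ext ⟨a, b⟩
  constructor
  · rintro ⟨⟨y, t⟩, ⟨⟨hy0, hy1⟩, ht0, ht1⟩, he⟩
    simp only [coneMap, Prod.mk.injEq] at he hy0 hy1 ht0 ht1
    obtain ⟨rfl, rfl⟩ := he
    refine ⟨mul_pos ht0 (sub_pos.2 hy1), mul_pos ht0 hy0, ?_⟩
    change t * (1 - y) + t * y < 1
    linarith
  · rintro ⟨ha, hb, hab⟩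
    change 0 < a at ha
    change 0 < b at hb
    change a + b < 1 at hab
    have hs : 0 < a + b := by linarith
    refine ⟨(b / (a + b), a + b), ⟨⟨div_pos hb hs, (div_lt_one hs).2 (by linarith)⟩, hs, hab⟩, ?_⟩
    simp only [coneMap, Prod.mk.injEq]
    constructor <;> field_simp
    ring

theorem simplexΔ_ae_eq : simplexΔ =ᵐ[volume] coneMap '' unitSquare := by
  have h1 : volume ((Prod.fst : ℝ × ℝ → ℝ) ⁻¹' {0}) = 0 :=
    Measure.quasiMeasurePreserving_fst.preimage_null (by simp)
  have h2 : volume ((Prod.snd : ℝ × ℝ → ℝ) ⁻¹' {0}) = 0 :=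
    Measure.quasiMeasurePreserving_snd.preimage_null (by simp)
  have h3 : volume ((fun p : ℝ × ℝ => p.1 + p.2) ⁻¹' {1}) = 0 := by
    -- The measure-preserving shear (x, y) ↦ (x, x + y) carries the hypotenuse into a horizontal
    -- line.
    have h := (Measure.quasiMeasurePreserving_snd (μ := (volume : Measure ℝ))
      (ν := (volume : Measure ℝ))).comp
      (measurePreserving_prod_add (volume : Measure ℝ) volume).quasiMeasurePreserving
    exact h.preimage_null (s := {1}) (by simp)
  rw [image_coneMap]
  filter_upwards [measure_eq_zero_iff_ae_notMem.1 h1, measure_eq_zero_iff_ae_notMem.1 h2,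
    measure_eq_zero_iff_ae_notMem.1 h3] with p hp1 hp2 hp3
  simp only [mem_preimage, mem_singleton_iff] at hp1 hp2 hp3
  apply propext
  change (0 ≤ p.1 ∧ 0 ≤ p.2 ∧ 0 ≤ 1 - p.1 - p.2) ↔ (0 < p.1 ∧ 0 < p.2 ∧ p.1 + p.2 < 1)
  constructor
  · rintro ⟨a, b, c⟩
    exact ⟨lt_of_le_of_ne a (Ne.symm hp1), lt_of_le_of_ne b (Ne.symm hp2),
      lt_of_le_of_ne (by linarith) hp3⟩
  · rintro ⟨a, b, c⟩
    exact ⟨a.le, b.le, by linarith⟩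

variable {E : Type*} [NormedAddCommGroup E] [NormedSpace ℝ E]

theorem setIntegral_simplexΔ (h : ℝ × ℝ → E) :
    ∫ p in simplexΔ, h p = ∫ p in unitSquare, p.2 • h (coneMap p) := by
  rw [setIntegral_congr_set simplexΔ_ae_eq,
    integral_image_eq_integral_abs_det_fderiv_smul volume measurableSet_unitSquare
      (fun p _ => (hasFDerivAt_coneMap p).hasFDerivWithinAt) injOn_coneMap]
  refine setIntegral_congr_fun measurableSet_unitSquare fun p hp => ?_
  simp only [abs_det_coneMapDeriv hp]

theorem integrableOn_simplexΔ_iff (h : ℝ × ℝ → E) :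
    IntegrableOn h simplexΔ ↔ IntegrableOn (fun p => p.2 • h (coneMap p)) unitSquare := by
  rw [integrableOn_congr_set_ae simplexΔ_ae_eq,
    integrableOn_image_iff_integrableOn_abs_det_fderiv_smul volume measurableSet_unitSquare
      (fun p _ => (hasFDerivAt_coneMap p).hasFDerivWithinAt) injOn_coneMap]
  refine integrableOn_congr_fun (fun p hp => ?_) measurableSet_unitSquare
  simp only [abs_det_coneMapDeriv hp]

theorem normSqEdge_nonneg (y : ℝ) : 0 ≤ normSqEdge y := by
  unfold normSqEdge; nlinarith [sq_nonneg (y - 1), sq_nonneg y]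

theorem normSqEdge_pos (y : ℝ) : 0 < normSqEdge y := by
  unfold normSqEdge; nlinarith [sq_nonneg (2 * y - 1)]

theorem normSqEdge_lt_one {y : ℝ} (hy : y ∈ Ioo (0 : ℝ) 1) : normSqEdge y < 1 := by
  unfold normSqEdge; nlinarith [mul_pos hy.1 (sub_pos.2 hy.2)]

theorem sq_mul_normSqEdge_lt_one {p : ℝ × ℝ} (hp : p ∈ unitSquare) :
    p.2 ^ 2 * normSqEdge p.1 < 1 := by
  have h1 := normSqEdge_lt_one hp.1
  have h2 : p.2 ^ 2 < 1 := pow_lt_one₀ hp.2.1.le hp.2.2 two_ne_zero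
  nlinarith [normSqEdge_nonneg p.1, sq_nonneg p.2]

theorem integrableOn_rpow_neg_half :
    IntegrableOn (fun y : ℝ => y ^ (-(1 / 2) : ℝ)) (Ioo 0 1) :=
  (intervalIntegrable_iff_integrableOn_Ioo_of_le zero_le_one).1
    (intervalIntegral.intervalIntegrable_rpow' (by norm_num))

theorem integrableOn_one_sub_rpow_neg_half :
    IntegrableOn (fun y : ℝ => (1 - y) ^ (-(1 / 2) : ℝ)) (Ioo 0 1) := by
  have h := (intervalIntegral.intervalIntegrable_rpow' (a := 0) (b := 1) (r := -(1 / 2))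
    (by norm_num)).comp_sub_left 1
  rw [sub_zero, sub_self] at h
  exact (intervalIntegrable_iff_integrableOn_Ioo_of_le zero_le_one).1 h.symm

/-- Splitting 1/d into two factors d^(-1/2) and bounding each by a different variable yields a
product of integrable singularities. -/
theorem inv_le_rpow_mul_rpow {a b d : ℝ} (ha : 0 < a) (hb : 0 < b) (had : a ≤ d) (hbd : b ≤ d) :
    d⁻¹ ≤ a ^ (-(1 / 2) : ℝ) * b ^ (-(1 / 2) : ℝ) := by
  have hd : 0 < d := ha.trans_le had
  have hs : d⁻¹ = d ^ (-(1 / 2) : ℝ) * d ^ (-(1 / 2) : ℝ) := by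
    rw [← Real.rpow_add hd, ← Real.rpow_neg_one]
    norm_num
  rw [hs]
  exact mul_le_mul (Real.rpow_le_rpow_of_nonpos ha had (by norm_num))
    (Real.rpow_le_rpow_of_nonpos hb hbd (by norm_num)) (by positivity) (by positivity)

/-- The denominator 1 - t²q is at least 1 - t and at least 1 - q = 2y(1 - y), and the latter is at
least the smaller of y and 1 - y. The separable majorant follows. -/
theorem integrableOn_poleKernel :
    IntegrableOn (fun p : ℝ × ℝ => (1 - p.2 ^ 2 * normSqEdge p.1)⁻¹) unitSquare := by
  have h : IntegrableOn (fun p : ℝ × ℝ => (p.1 ^ (-(1 / 2) : ℝ) + (1 - p.1) ^ (-(1 / 2) : ℝ)) *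
      (1 - p.2) ^ (-(1 / 2) : ℝ)) unitSquare := by
    have := (integrableOn_rpow_neg_half.add integrableOn_one_sub_rpow_neg_half).mul_prod
      integrableOn_one_sub_rpow_neg_half
    rwa [Measure.prod_restrict] at this
  refine Integrable.mono' h ?_ ?_
  · refine Measurable.aestronglyMeasurable ?_
    unfold normSqEdge
    fun_prop
  · refine (ae_restrict_iff' measurableSet_unitSquare).2 (Filter.Eventually.of_forall fun p hp => ?_)
    have hlt := sq_mul_normSqEdge_lt_one hp
    obtain ⟨⟨hy0, hy1⟩, ht0, ht1⟩ := hp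
    have hq : normSqEdge p.1 ≤ 1 := (normSqEdge_lt_one ⟨hy0, hy1⟩).le
    have hq0 := normSqEdge_nonneg p.1
    have ht : p.2 ^ 2 ≤ p.2 := by nlinarith
    have ha : 1 - p.2 ≤ 1 - p.2 ^ 2 * normSqEdge p.1 := by nlinarith
    have hb : 1 - normSqEdge p.1 ≤ 1 - p.2 ^ 2 * normSqEdge p.1 := by nlinarith
    rw [Real.norm_eq_abs, abs_of_nonneg (inv_nonneg.2 (sub_nonneg.2 hlt.le)), add_mul]
    have hp1 : 0 ≤ p.1 ^ (-(1 / 2) : ℝ) * (1 - p.2) ^ (-(1 / 2) : ℝ) :=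
      mul_nonneg (Real.rpow_nonneg hy0.le _) (Real.rpow_nonneg (sub_nonneg.2 ht1.le) _)
    have hp2 : 0 ≤ (1 - p.1) ^ (-(1 / 2) : ℝ) * (1 - p.2) ^ (-(1 / 2) : ℝ) :=
      mul_nonneg (Real.rpow_nonneg (sub_nonneg.2 hy1.le) _)
        (Real.rpow_nonneg (sub_nonneg.2 ht1.le) _)
    rcases le_total p.1 (1 / 2) with hy | hy
    · have := inv_le_rpow_mul_rpow hy0 (sub_pos.2 ht1) (le_trans ?_ hb) ha
      · linarith
      · unfold normSqEdge; nlinarith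
    · have := inv_le_rpow_mul_rpow (sub_pos.2 hy1) (sub_pos.2 ht1) (le_trans ?_ hb) ha
      · linarith
      · unfold normSqEdge; nlinarith

theorem integrableOn_mul_poleKernel {g : ℝ × ℝ → ℝ} (hg : Continuous g) :
    IntegrableOn (fun p : ℝ × ℝ => g p * (1 - p.2 ^ 2 * normSqEdge p.1)⁻¹) unitSquare := by
  obtain ⟨c, hc⟩ := (isCompact_Icc.prod isCompact_Icc : IsCompact
    (Icc (0 : ℝ) 1 ×ˢ Icc (0 : ℝ) 1)).exists_bound_of_continuousOn hg.continuousOn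
  refine integrableOn_poleKernel.bdd_mul (c := c) hg.aestronglyMeasurable ?_
  refine (ae_restrict_iff' measurableSet_unitSquare).2 (Filter.Eventually.of_forall fun p hp => ?_)
  exact hc p ⟨Ioo_subset_Icc_self hp.1, Ioo_subset_Icc_self hp.2⟩

theorem integrableOn_simplePoleFun (F : MvPolynomial (Fin 2) ℤ) :
    IntegrableOn (simplePoleFun F) simplexΔ := by
  rw [integrableOn_simplexΔ_iff]
  have hc : Continuous fun p : ℝ × ℝ =>
      p.2 * MvPolynomial.aeval ![(coneMap p).1, (coneMap p).2] F := by
    unfold coneMap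
    simp only [MvPolynomial.aeval_def, MvPolynomial.eval₂_eq', Fin.prod_univ_two,
      Matrix.cons_val_zero, Matrix.cons_val_one]
    fun_prop
  refine (integrableOn_mul_poleKernel hc).congr_fun (fun p _ => ?_) measurableSet_unitSquare
  have h : 1 - (coneMap p).1 ^ 2 - (coneMap p).2 ^ 2 = 1 - p.2 ^ 2 * normSqEdge p.1 := by
    unfold coneMap normSqEdge
    ring
  simp only [simplePoleFun, smul_eq_mul, h, div_eq_mul_inv, mul_assoc]

/-- The integral over the simplex of the function which is homogeneous of degree `n` and equal to
`g y` at `(1 - y, y)`, divided by `1 - x ^ 2 - y ^ 2`. -/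
def coneIntegral (n : ℕ) (g : ℝ → ℂ) : ℂ :=
  ∫ p in unitSquare, g p.1 * ((p.2 ^ (n + 1) * (1 - p.2 ^ 2 * normSqEdge p.1)⁻¹ : ℝ) : ℂ)

theorem integrableOn_coneIntegrand (n : ℕ) {g : ℝ → ℂ} (hg : Continuous g) :
    IntegrableOn (fun p : ℝ × ℝ =>
      g p.1 * ((p.2 ^ (n + 1) * (1 - p.2 ^ 2 * normSqEdge p.1)⁻¹ : ℝ) : ℂ)) unitSquare := by
  obtain ⟨c, hc⟩ := (isCompact_Icc : IsCompact (Icc (0 : ℝ) 1)).exists_bound_of_continuousOn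
    hg.continuousOn
  have h : IntegrableOn (fun p : ℝ × ℝ => p.2 ^ (n + 1) * (1 - p.2 ^ 2 * normSqEdge p.1)⁻¹)
    unitSquare := integrableOn_mul_poleKernel (by fun_prop)
  refine h.ofReal.bdd_mul (c := c) (hg.comp continuous_fst).aestronglyMeasurable ?_
  refine (ae_restrict_iff' measurableSet_unitSquare).2 (Filter.Eventually.of_forall fun p hp => ?_)
  exact hc p.1 (Ioo_subset_Icc_self hp.1)

theorem integral_Ioo_pow (n : ℕ) : ∫ t in Ioo (0 : ℝ) 1, t ^ n = 1 / ((n : ℝ) + 1) := by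
  rw [← integral_Ioc_eq_integral_Ioo, ← intervalIntegral.integral_of_le zero_le_one, integral_pow]
  simp

theorem hasSum_of_forall_eq {f g : ℕ → ℂ} {a : ℂ} (hg : HasSum g a) (h : ∀ m, f m = g m) :
    HasSum f a := by
  rwa [funext h]

/-- Expand the pole geometrically. The power of t in the m-th term is n + 1 + 2m, where the 1 is the
Jacobian. The norms of the terms sum to the norm of the full integrand, which is integrable, so
dominated convergence applies. -/
theorem hasSum_coneIntegral (n : ℕ) {g : ℝ → ℂ} (hg : Continuous g) :
    HasSum (fun m : ℕ => 1 / ((n : ℂ) + 2 * m + 2) *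
      ∫ y in (0 : ℝ)..1, g y * (normSqEdge y : ℂ) ^ m) (coneIntegral n g) := by
  have hgeom : ∀ p ∈ unitSquare, HasSum (fun m : ℕ => (p.2 ^ 2 * normSqEdge p.1) ^ m)
      (1 - p.2 ^ 2 * normSqEdge p.1)⁻¹ := fun p hp =>
    hasSum_geometric_of_lt_one (mul_nonneg (sq_nonneg _) (normSqEdge_nonneg _))
      (sq_mul_normSqEdge_lt_one hp)
  have hq : Continuous normSqEdge := by unfold normSqEdge; fun_prop
  have hg' : Continuous fun p : ℝ × ℝ => g p.1 := hg.comp continuous_fst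
  have hq' : Continuous fun p : ℝ × ℝ => normSqEdge p.1 := hq.comp continuous_fst
  have hsum : ∀ p ∈ unitSquare, HasSum (fun m : ℕ => ‖g p.1‖ * (p.2 ^ (n + 1) *
      (p.2 ^ 2 * normSqEdge p.1) ^ m))
      (‖g p.1‖ * (p.2 ^ (n + 1) * (1 - p.2 ^ 2 * normSqEdge p.1)⁻¹)) := fun p hp =>
    ((hgeom p hp).mul_left _).mul_left _
  have key := hasSum_integral_of_dominated_convergence (μ := volume.restrict unitSquare)
    (F := fun (m : ℕ) (p : ℝ × ℝ) => g p.1 *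
      ((p.2 ^ (n + 1) * (p.2 ^ 2 * normSqEdge p.1) ^ m : ℝ) : ℂ))
    (f := fun p => g p.1 * ((p.2 ^ (n + 1) * (1 - p.2 ^ 2 * normSqEdge p.1)⁻¹ : ℝ) : ℂ))
    (fun m p => ‖g p.1‖ * (p.2 ^ (n + 1) * (p.2 ^ 2 * normSqEdge p.1) ^ m))
    (fun m => Continuous.aestronglyMeasurable (by fun_prop))
    (fun m => (ae_restrict_iff' measurableSet_unitSquare).2 (Filter.Eventually.of_forall
      fun p hp => by
        rw [norm_mul, Complex.norm_real, Real.norm_eq_abs, abs_of_nonneg]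
        have := normSqEdge_nonneg p.1
        have := hp.2.1.le
        positivity))
    ((ae_restrict_iff' measurableSet_unitSquare).2 (Filter.Eventually.of_forall
      fun p hp => (hsum p hp).summable))
    ?_
    ((ae_restrict_iff' measurableSet_unitSquare).2 (Filter.Eventually.of_forall
      fun p hp => (Complex.hasSum_ofReal.2 ((hgeom p hp).mul_left _)).mul_left _))
  · refine hasSum_of_forall_eq key fun m => ?_
    have h1 : ∀ p : ℝ × ℝ, g p.1 * ((p.2 ^ (n + 1) * (p.2 ^ 2 * normSqEdge p.1) ^ m : ℝ) : ℂ) =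
        (g p.1 * (normSqEdge p.1 : ℂ) ^ m) * ((p.2 ^ (n + 1 + 2 * m) : ℝ) : ℂ) := by
      intro p
      push_cast
      ring
    have h2 : ∫ t in Ioo (0 : ℝ) 1, ((t ^ (n + 1 + 2 * m) : ℝ) : ℂ) =
        1 / ((n : ℂ) + 2 * m + 2) := by
      rw [integral_complex_ofReal, integral_Ioo_pow]
      push_cast
      congr 1
      ring
    simp only [h1]
    rw [unitSquare, Measure.volume_eq_prod, setIntegral_prod_mul (L := ℂ)
      (fun y => g y * (normSqEdge y : ℂ) ^ m) (fun t => ((t ^ (n + 1 + 2 * m) : ℝ) : ℂ)),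
      h2, mul_comm, intervalIntegral.integral_of_le zero_le_one, integral_Ioc_eq_integral_Ioo]
  · refine (integrableOn_coneIntegrand n hg).norm.congr ?_
    refine (ae_restrict_iff' measurableSet_unitSquare).2 (Filter.Eventually.of_forall
      fun p hp => ?_)
    simp only [(hsum p hp).tsum_eq]
    rw [norm_mul, Complex.norm_real, Real.norm_eq_abs, abs_of_nonneg]
    have := sq_mul_normSqEdge_lt_one hp
    exact mul_nonneg (pow_nonneg hp.2.1.le _) (inv_nonneg.2 (by linarith))

end ConeCoordinates

/-! ### Integration by parts along the edge, and summation of the series. -/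

section EdgeIntegrals

open MeasureTheory Set

theorem coneIntegral_add (n : ℕ) {g h : ℝ → ℂ} (hg : Continuous g) (hh : Continuous h) :
    coneIntegral n (fun y => g y + h y) = coneIntegral n g + coneIntegral n h := by
  simp only [coneIntegral, add_mul]
  exact integral_add (integrableOn_coneIntegrand n hg) (integrableOn_coneIntegrand n hh)

/-- The value of `z ^ k * w ^ l` at the point `(1 - y, y)`. -/
def zwEdge (k l : ℕ) (y : ℝ) : ℂ :=
  (1 - (y : ℂ) + Complex.I * y) ^ k * (1 - (y : ℂ) - Complex.I * y) ^ l

theorem continuous_zwEdge (k l : ℕ) : Continuous (zwEdge k l) := by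
  unfold zwEdge; fun_prop

theorem continuous_normSqEdge : Continuous normSqEdge := by unfold normSqEdge; fun_prop

theorem ofReal_normSqEdge (y : ℝ) : (normSqEdge y : ℂ) =
    (1 - (y : ℂ) + Complex.I * y) * (1 - (y : ℂ) - Complex.I * y) := by
  unfold normSqEdge
  push_cast
  linear_combination ((y : ℂ) ^ 2) * Complex.I_sq

theorem zwEdge_mul_normSqEdge_pow (k l m : ℕ) (y : ℝ) :
    zwEdge k l y * (normSqEdge y : ℂ) ^ m = zwEdge (k + m) (l + m) y := by
  rw [ofReal_normSqEdge, mul_pow]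
  unfold zwEdge
  ring

theorem hasDerivAt_zwEdge (k l : ℕ) (y : ℝ) :
    HasDerivAt (zwEdge (k + 1) (l + 1))
      (zwEdge k l y * (((k : ℂ) + l + 2) * (2 * y - 1) + Complex.I * ((k : ℂ) - l))) y := by
  have h0 : HasDerivAt (fun y : ℝ => (y : ℂ)) 1 y := Complex.ofRealCLM.hasDerivAt
  have h1 : HasDerivAt (fun y : ℝ => 1 - (y : ℂ) + Complex.I * y) (-1 + Complex.I * 1) y :=
    (h0.const_sub 1).add (h0.const_mul Complex.I)
  have h2 : HasDerivAt (fun y : ℝ => 1 - (y : ℂ) - Complex.I * y) (-1 - Complex.I * 1) y :=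
    (h0.const_sub 1).sub (h0.const_mul Complex.I)
  refine ((h1.pow (k + 1)).mul (h2.pow (l + 1))).congr_deriv ?_
  unfold zwEdge
  simp only [Nat.add_sub_cancel, Pi.pow_apply]
  push_cast
  generalize ha : 1 - (y : ℂ) + Complex.I * y = a
  generalize hb : 1 - (y : ℂ) - Complex.I * y = b
  have e1 : b * (-1 + Complex.I * 1) = (2 * y - 1) + Complex.I := by
    rw [← hb]; linear_combination (-(y : ℂ)) * Complex.I_sq
  have e2 : a * (-1 - Complex.I * 1) = (2 * y - 1) - Complex.I := by
    rw [← ha]; linear_combination (-(y : ℂ)) * Complex.I_sq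
  linear_combination (a ^ k * b ^ l * (k + 1)) * e1 + (a ^ k * b ^ l * (l + 1)) * e2

theorem fPoly_edge (k l : ℕ) (y : ℝ) :
    fPoly k l (1 - (y : ℂ)) y = zwEdge k l y - zwEdge l k y := rfl

theorem continuous_fPoly_edge (k l : ℕ) : Continuous fun y : ℝ => fPoly k l (1 - (y : ℂ)) y :=
  (continuous_zwEdge k l).sub (continuous_zwEdge l k)

/-- Integration by parts along the edge of the simplex. -/
theorem integral_zwEdge_add (k l m : ℕ) (hkl : k ≡ l [MOD 4]) :
    Complex.I * ((k : ℂ) - l) * ∫ y in (0 : ℝ)..1,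
        (zwEdge k l y + zwEdge l k y) * (normSqEdge y : ℂ) ^ m =
      ((k : ℂ) + l + 2 * m + 2) * ∫ y in (0 : ℝ)..1,
        (1 - 2 * (y : ℂ)) * fPoly k l (1 - (y : ℂ)) y * (normSqEdge y : ℂ) ^ m := by
  have hq := continuous_normSqEdge
  have hz := continuous_zwEdge k l
  have hz' := continuous_zwEdge l k
  have hf := continuous_fPoly_edge k l
  -- The endpoints have z = w = 1 and z = i, w = -i. The congruence makes the antisymmetrised
  -- monomial vanish at both.
  have hI : Complex.I ^ k = Complex.I ^ l := by
    rw [Complex.I_pow_eq_pow_mod k, Complex.I_pow_eq_pow_mod l, show k % 4 = l % 4 from hkl]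
  have hJ : (-Complex.I) ^ k = (-Complex.I) ^ l := by
    rw [← Complex.inv_I, inv_pow, inv_pow, hI]
  have key := intervalIntegral.integral_eq_sub_of_hasDerivAt (a := 0) (b := 1)
    (fun y _ => (hasDerivAt_zwEdge (k + m) (l + m) y).sub (hasDerivAt_zwEdge (l + m) (k + m) y))
    (Continuous.intervalIntegrable (by
      have := continuous_zwEdge (k + m) (l + m)
      have := continuous_zwEdge (l + m) (k + m)
      fun_prop) _ _)
  have hend : (zwEdge (k + m + 1) (l + m + 1) - zwEdge (l + m + 1) (k + m + 1)) 1 -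
      (zwEdge (k + m + 1) (l + m + 1) - zwEdge (l + m + 1) (k + m + 1)) 0 = 0 := by
    simp only [Pi.sub_apply, zwEdge, Complex.ofReal_one, Complex.ofReal_zero, sub_self, mul_zero,
      mul_one, zero_add, zero_sub, sub_zero, add_zero, one_pow, pow_add, hI, hJ]
  rw [hend] at key
  rw [← intervalIntegral.integral_const_mul, ← intervalIntegral.integral_const_mul, ← sub_eq_zero,
    ← intervalIntegral.integral_sub (Continuous.intervalIntegrable (by fun_prop) _ _)
      (Continuous.intervalIntegrable (by fun_prop) _ _), ← key]
  refine intervalIntegral.integral_congr fun y _ => ?_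
  simp only [← zwEdge_mul_normSqEdge_pow k l m, ← zwEdge_mul_normSqEdge_pow l k m, fPoly_edge]
  push_cast
  ring

theorem firstIntegrand_eq (k l : ℕ) (y : ℝ) : firstIntegrand k l y =
    -2 * Complex.I * ((1 - 2 * (y : ℂ)) * fPoly k l (1 - (y : ℂ)) y *
      ((1 - normSqEdge y : ℝ) : ℂ)⁻¹) := by
  have h : ((1 - normSqEdge y : ℝ) : ℂ) = 2 * (y * (1 - y)) := by
    unfold normSqEdge
    push_cast
    ring
  rw [h, firstIntegrand, mul_inv, div_eq_mul_inv]
  ring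

/-- The factor 1/(1 - q) produced by the geometric series is singular at both ends of the edge. The
zeros of f cancel it, so the sum of the norms is half the norm of a polynomial and hence integrable.
-/
theorem hasSum_integral_fPoly {k l : ℕ} (hlk : l < k) (hkl : k ≡ l [MOD 4]) :
    HasSum (fun m : ℕ => ∫ y in (0 : ℝ)..1,
        (1 - 2 * (y : ℂ)) * fPoly k l (1 - (y : ℂ)) y * (normSqEdge y : ℂ) ^ m)
      (Complex.I / 2 * ∫ y in (0 : ℝ)..1, firstIntegrand k l y) := by
  obtain ⟨p, -, hp⟩ := exists_firstIntegrand_eq k l hlk hkl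
  have hf := continuous_fPoly_edge k l
  have hq := continuous_normSqEdge
  have hgeom : ∀ y ∈ Ioo (0 : ℝ) 1, HasSum (fun m : ℕ => normSqEdge y ^ m) (1 - normSqEdge y)⁻¹ :=
    fun y hy => hasSum_geometric_of_lt_one (normSqEdge_nonneg y) (normSqEdge_lt_one hy)
  have hsum : ∀ y ∈ Ioo (0 : ℝ) 1, HasSum (fun m : ℕ =>
      ‖(1 - 2 * (y : ℂ)) * fPoly k l (1 - (y : ℂ)) y‖ * normSqEdge y ^ m)
      (‖(1 - 2 * (y : ℂ)) * fPoly k l (1 - (y : ℂ)) y‖ * (1 - normSqEdge y)⁻¹) :=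
    fun y hy => (hgeom y hy).mul_left _
  simp only [intervalIntegral.integral_of_le zero_le_one, integral_Ioc_eq_integral_Ioo]
  have hae : ∀ {P : ℝ → Prop}, (∀ y ∈ Ioo (0 : ℝ) 1, P y) →
      ∀ᵐ y ∂volume.restrict (Ioo (0 : ℝ) 1), P y := fun h =>
    (ae_restrict_iff' measurableSet_Ioo).2 (Filter.Eventually.of_forall h)
  rw [← integral_const_mul]
  refine hasSum_integral_of_dominated_convergence
    (fun m y => ‖(1 - 2 * (y : ℂ)) * fPoly k l (1 - (y : ℂ)) y‖ * normSqEdge y ^ m)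
    (fun m => Continuous.aestronglyMeasurable (by fun_prop))
    (fun m => hae fun y _ => ?_) (hae fun y hy => (hsum y hy).summable) ?_ (hae fun y hy => ?_)
  · rw [norm_mul, norm_pow, Complex.norm_real, Real.norm_eq_abs,
      abs_of_nonneg (normSqEdge_nonneg y)]
  · have hi : IntegrableOn (fun y : ℝ => 1 / 2 * ‖Polynomial.aeval (y : ℂ) p‖) (Ioo 0 1) := by
      refine IntegrableOn.mono_set (t := Icc 0 1) ?_ Ioo_subset_Icc_self
      exact Continuous.integrableOn_Icc (by fun_prop)
    refine hi.congr (hae fun y hy => ?_)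
    simp only [(hsum y hy).tsum_eq]
    rw [← hp y hy.1 hy.2, firstIntegrand_eq, norm_mul, norm_mul _ (Complex.ofReal _)⁻¹,
      norm_inv, Complex.norm_real, Real.norm_eq_abs,
      abs_of_nonneg (sub_nonneg.2 (normSqEdge_lt_one hy).le)]
    simp
  · have h := (Complex.hasSum_ofReal.2 (hgeom y hy)).mul_left
      ((1 - 2 * (y : ℂ)) * fPoly k l (1 - (y : ℂ)) y)
    have e : Complex.I / 2 * firstIntegrand k l y =
        (1 - 2 * (y : ℂ)) * fPoly k l (1 - (y : ℂ)) y * (((1 - normSqEdge y)⁻¹ : ℝ) : ℂ) := by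
      rw [firstIntegrand_eq, Complex.ofReal_inv]
      linear_combination (-((1 - 2 * (y : ℂ)) * fPoly k l (1 - (y : ℂ)) y *
        ((1 - normSqEdge y : ℝ) : ℂ)⁻¹)) * Complex.I_sq
    rw [e]
    simpa only [Complex.ofReal_pow] using h

/-- Integration by parts trades the weight 1/(k + l + 2m + 2) for 1/(i(k - l)), which no longer
depends on m. -/
theorem coneIntegral_zwEdge_add {k l : ℕ} (hlk : l < k) (hkl : k ≡ l [MOD 4]) :
    coneIntegral (k + l) (zwEdge k l) + coneIntegral (k + l) (zwEdge l k) = firstIntegral k l := by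
  rw [← coneIntegral_add _ (continuous_zwEdge k l) (continuous_zwEdge l k)]
  have h1 := hasSum_coneIntegral (k + l) ((continuous_zwEdge k l).add (continuous_zwEdge l k))
  have h2 := (hasSum_integral_fPoly hlk hkl).mul_left (1 / (Complex.I * ((k : ℂ) - l)))
  have hne : (k : ℂ) - l ≠ 0 := sub_ne_zero.2 (by exact_mod_cast hlk.ne')
  have h3 := h1.unique (hasSum_of_forall_eq h2 fun m => ?_)
  · refine h3.trans ?_
    rw [firstIntegral]
    field_simp
  · have hm : ((k : ℂ) + l + 2 * m + 2) ≠ 0 := by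
      have : ((k + l + 2 * m + 2 : ℕ) : ℂ) ≠ 0 := Nat.cast_ne_zero.2 (by omega)
      exact_mod_cast this
    have h := integral_zwEdge_add k l m hkl
    rw [one_div_mul_eq_div, one_div_mul_eq_div, Nat.cast_add,
      div_eq_div_iff hm (mul_ne_zero Complex.I_ne_zero hne), mul_comm]
    exact h.trans (mul_comm _ _)

/-- On the edge z^k w^k = q^k, so the m-th term here is term m + k of the series for the constant 1.
The difference is its first k terms. -/
theorem coneIntegral_zwEdge_self (k : ℕ) :
    coneIntegral (k + k) (zwEdge k k) = coneIntegral 0 (fun _ => 1) + secondIntegral k := by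
  have h1 := hasSum_coneIntegral (k + k) (continuous_zwEdge k k)
  have h2 := hasSum_coneIntegral 0 (g := fun _ => 1) continuous_const
  rw [← sub_add_cancel (coneIntegral 0 fun _ => 1) (∑ i ∈ Finset.range k,
    1 / (((0 : ℕ) : ℂ) + 2 * i + 2) * ∫ y in (0 : ℝ)..1, 1 * (normSqEdge y : ℂ) ^ i),
    ← hasSum_nat_add_iff k] at h2
  have hs : (secondIntegral k : ℂ) = -∑ i ∈ Finset.range k,
      1 / (((0 : ℕ) : ℂ) + 2 * i + 2) * ∫ y in (0 : ℝ)..1, 1 * (normSqEdge y : ℂ) ^ i := by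
    rw [secondIntegral, intervalIntegral.integral_finsetSum fun i _ =>
      (by fun_prop : Continuous _).intervalIntegrable _ _, neg_mul, Complex.ofReal_neg,
      Finset.mul_sum, Complex.ofReal_sum]
    congr 1
    refine Finset.sum_congr rfl fun j _ => ?_
    have hj : ((j : ℂ) + 1) ≠ 0 := Nat.cast_add_one_ne_zero j
    have hi : ∫ y in (0 : ℝ)..1, 1 * (normSqEdge y : ℂ) ^ j =
        ((∫ y in (0 : ℝ)..1, (2 * y ^ 2 - 2 * y + 1) ^ j : ℝ) : ℂ) := by
      rw [← intervalIntegral.integral_ofReal]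
      simp [normSqEdge]
    rw [hi, intervalIntegral.integral_const_mul]
    push_cast
    rw [← mul_assoc]
    congr 1
    rw [zero_add, show (2 : ℂ) * j + 2 = 2 * (j + 1) by ring]
    field_simp
  rw [hs, ← sub_eq_add_neg]
  refine h1.unique (hasSum_of_forall_eq h2 fun m => ?_)
  have e : ∀ y, zwEdge k k y * (normSqEdge y : ℂ) ^ m = 1 * (normSqEdge y : ℂ) ^ (m + k) := by
    intro y
    rw [pow_add, ofReal_normSqEdge, mul_pow, mul_pow, zwEdge]
    ring
  simp only [e]
  push_cast
  congr 2
  ring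

end EdgeIntegrals

/-! ### The case F = 1: evaluation by the Catalan constant. -/

section CatalanIntegral

open MeasureTheory Set

theorem integral_pow_mul_neg_log (n : ℕ) :
    ∫ u in (0 : ℝ)..1, u ^ n * -Real.log u = 1 / ((n : ℝ) + 1) ^ 2 := by
  have hn : ((n : ℝ) + 1) ≠ 0 := by positivity
  have h := intervalIntegral.integral_eq_sub_of_hasDerivAt_of_le (a := 0) (b := 1)
    -- Grouping u log u makes the antiderivative visibly continuous at 0, even for n = 0.
    (f := fun u => u ^ (n + 1) / ((n : ℝ) + 1) ^ 2 - u ^ n * (u * Real.log u) / ((n : ℝ) + 1))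
    (f' := fun u => u ^ n * -Real.log u) zero_le_one ?_ ?_ ?_
  · rw [h]
    simp
  · have := Real.continuous_mul_log
    fun_prop
  · intro u hu
    have hu0 : u ≠ 0 := hu.1.ne'
    have h1 : HasDerivAt (fun u : ℝ => u ^ (n + 1) * (1 / ((n : ℝ) + 1) ^ 2 -
        Real.log u / ((n : ℝ) + 1))) (u ^ n * -Real.log u) u := by
      refine ((hasDerivAt_pow (n + 1) u).mul
        (((Real.hasDerivAt_log hu0).div_const _).const_sub _)).congr_deriv ?_
      push_cast
      field_simp
      ring
    refine h1.congr_of_eventuallyEq (Filter.Eventually.of_forall fun v => ?_)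
    ring
  · exact intervalIntegral.intervalIntegrable_log'.neg.continuousOn_mul
      (continuous_pow n).continuousOn

theorem integrableOn_pow_mul_neg_log (n : ℕ) :
    IntegrableOn (fun u : ℝ => u ^ n * -Real.log u) (Ioo 0 1) :=
  (intervalIntegrable_iff_integrableOn_Ioo_of_le zero_le_one).1
    (intervalIntegral.intervalIntegrable_log'.neg.continuousOn_mul (continuous_pow n).continuousOn)

theorem integral_Ioo_pow_mul_neg_log (n : ℕ) :
    ∫ u in Ioo (0 : ℝ) 1, u ^ n * -Real.log u = 1 / ((n : ℝ) + 1) ^ 2 := by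
  rw [← integral_pow_mul_neg_log, intervalIntegral.integral_of_le zero_le_one,
    integral_Ioc_eq_integral_Ioo]

/-- Expand 1/(1 + u²) geometrically and integrate termwise. The absolute integrals are 1/(2n + 1)²,
which are summable. -/
theorem integral_neg_log_div_eq_catalanG :
    ∫ u in Ioo (0 : ℝ) 1, -Real.log u / (1 + u ^ 2) = catalanG := by
  have h := hasSum_integral_of_summable_integral_norm (μ := volume.restrict (Ioo (0 : ℝ) 1))
    (F := fun (n : ℕ) (u : ℝ) => (-1 : ℝ) ^ n * (u ^ (2 * n) * -Real.log u))
    (fun n => (integrableOn_pow_mul_neg_log (2 * n)).const_mul _) ?_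
  · have e1 : ∀ n : ℕ, ∫ u in Ioo (0 : ℝ) 1, (-1 : ℝ) ^ n * (u ^ (2 * n) * -Real.log u) =
        (-1 : ℝ) ^ n / (2 * (n : ℝ) + 1) ^ 2 := by
      intro n
      rw [integral_const_mul, integral_Ioo_pow_mul_neg_log]
      push_cast
      ring
    simp only [e1] at h
    rw [catalanG, h.tsum_eq]
    refine setIntegral_congr_fun measurableSet_Ioo fun u hu => ?_
    have hu2 : u ^ 2 < 1 := pow_lt_one₀ hu.1.le hu.2 two_ne_zero
    have hg := (hasSum_geometric_of_abs_lt_one (r := -u ^ 2)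
      (by rw [abs_neg, abs_of_nonneg (sq_nonneg u)]; exact hu2)).mul_right (-Real.log u)
    have e2 : ∀ n : ℕ, (-1 : ℝ) ^ n * (u ^ (2 * n) * -Real.log u) =
        (-u ^ 2) ^ n * -Real.log u := by
      intro n
      rw [neg_pow (u ^ 2), ← pow_mul]
      ring
    simp only [e2, hg.tsum_eq]
    rw [sub_neg_eq_add, div_eq_mul_inv, mul_comm]
  · have e : ∀ n : ℕ, ∫ u in Ioo (0 : ℝ) 1, ‖(-1 : ℝ) ^ n * (u ^ (2 * n) * -Real.log u)‖ =
        1 / (((2 * n : ℕ) : ℝ) + 1) ^ 2 := by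
      intro n
      rw [← integral_Ioo_pow_mul_neg_log]
      refine setIntegral_congr_fun measurableSet_Ioo fun u hu => ?_
      have := Real.log_nonpos hu.1.le hu.2.le
      have h0 : 0 ≤ u ^ (2 * n) * -Real.log u :=
        mul_nonneg (pow_nonneg hu.1.le _) (by linarith)
      simp only [norm_mul, norm_pow, norm_neg, norm_one, one_pow, one_mul, Real.norm_eq_abs]
      rw [← abs_of_nonneg h0, abs_mul, abs_pow, abs_neg]
    simp only [e]
    have hs := (Real.summable_one_div_nat_pow (p := 2)).2 one_lt_two
    refine (hs.comp_injective (i := fun n : ℕ => 2 * n + 1) ?_).congr fun n => ?_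
    · intro a b hab
      simp only at hab
      omega
    · simp

/-- The involution `u ↦ (1 - u) / (1 + u)` reverses the sign of the integrand. -/
theorem integral_serret :
    ∫ u in Ioo (0 : ℝ) 1, (2 * Real.log (1 + u) - Real.log 2) / (1 + u ^ 2) = 0 := by
  have himg : (fun u : ℝ => (1 - u) / (1 + u)) '' Ioo 0 1 = Ioo 0 1 := by
    have hmem : ∀ u ∈ Ioo (0 : ℝ) 1, (1 - u) / (1 + u) ∈ Ioo (0 : ℝ) 1 := by
      rintro u ⟨h0, h1⟩
      have : 0 < 1 + u := by linarith
      exact ⟨div_pos (by linarith) this, (div_lt_one this).2 (by linarith)⟩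
    refine Subset.antisymm (image_subset_iff.2 hmem) fun u hu => ⟨_, hmem u hu, ?_⟩
    have : 1 + u ≠ 0 := by linarith [hu.1]
    field_simp
    ring
  have hinj : InjOn (fun u : ℝ => (1 - u) / (1 + u)) (Ioo 0 1) := by
    intro u hu v hv h
    have h1 : 1 + u ≠ 0 := by linarith [hu.1]
    have h2 : 1 + v ≠ 0 := by linarith [hv.1]
    simp only at h
    rw [div_eq_div_iff h1 h2] at h
    linarith
  have hder : ∀ u ∈ Ioo (0 : ℝ) 1, HasDerivWithinAt (fun u : ℝ => (1 - u) / (1 + u))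
      (-2 / (1 + u) ^ 2) (Ioo 0 1) u := by
    intro u hu
    have h1 : 1 + u ≠ 0 := by linarith [hu.1]
    refine HasDerivAt.hasDerivWithinAt ?_
    refine (((hasDerivAt_id u).const_sub 1).div ((hasDerivAt_id u).const_add 1) h1).congr_deriv ?_
    simp only [id]
    congr 1
    ring
  have h := integral_image_eq_integral_abs_deriv_smul measurableSet_Ioo hder hinj
    (fun u => (2 * Real.log (1 + u) - Real.log 2) / (1 + u ^ 2))
  rw [himg] at h
  have h' : ∫ u in Ioo (0 : ℝ) 1, |-2 / (1 + u) ^ 2| •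
      ((2 * Real.log (1 + (1 - u) / (1 + u)) - Real.log 2) / (1 + ((1 - u) / (1 + u)) ^ 2)) =
      ∫ u in Ioo (0 : ℝ) 1, -((2 * Real.log (1 + u) - Real.log 2) / (1 + u ^ 2)) := by
    refine setIntegral_congr_fun measurableSet_Ioo fun u hu => ?_
    have h1 : 0 < 1 + u := by linarith [hu.1]
    -- This identity turns 2 log(1 + u) - log 2 into its negative, while du/(1 + u²) is preserved in
    -- absolute value.
    have e : 1 + (1 - u) / (1 + u) = 2 / (1 + u) := by
      field_simp
      ring
    have e2 : 1 + ((1 - u) / (1 + u)) ^ 2 = 2 * (1 + u ^ 2) / (1 + u) ^ 2 := by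
      field_simp
      ring
    have e3 : |-2 / (1 + u) ^ 2| = 2 / (1 + u) ^ 2 := by
      rw [abs_div, abs_neg, abs_of_pos (two_pos), abs_of_pos (pow_pos h1 2)]
    simp only [e, e2, e3, Real.log_div two_ne_zero h1.ne', smul_eq_mul]
    field_simp
    ring
  rw [h', integral_neg] at h
  linarith

/-- The radial integral, as a function of the slope. -/
def logKernel (y : ℝ) : ℝ := -Real.log (1 - normSqEdge y) / (2 * normSqEdge y)

theorem integral_radial {y : ℝ} (hy : y ∈ Ioo (0 : ℝ) 1) :
    ∫ t in Ioo (0 : ℝ) 1, t * (1 - t ^ 2 * normSqEdge y)⁻¹ = logKernel y := by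
  have hq := normSqEdge_pos y
  have hq1 := normSqEdge_lt_one hy
  have hpos : ∀ t ∈ uIcc (0 : ℝ) 1, 1 - t ^ 2 * normSqEdge y ≠ 0 := by
    intro t ht
    rw [uIcc_of_le zero_le_one] at ht
    have : t ^ 2 ≤ 1 := pow_le_one₀ ht.1 ht.2
    nlinarith
  rw [← integral_Ioc_eq_integral_Ioo, ← intervalIntegral.integral_of_le zero_le_one,
    intervalIntegral.integral_eq_sub_of_hasDerivAt (a := 0) (b := 1)
      (f := fun t => -Real.log (1 - t ^ 2 * normSqEdge y) / (2 * normSqEdge y))]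
  · simp [logKernel]
  · intro t ht
    refine (((((hasDerivAt_pow 2 t).mul_const (normSqEdge y)).const_sub 1).log
      (hpos t ht)).neg.div_const _).congr_deriv ?_
    have := hpos t ht
    field_simp
    ring
  · refine ContinuousOn.intervalIntegrable ?_
    exact continuousOn_id.mul (ContinuousOn.inv₀ (by fun_prop) hpos)

theorem integrableOn_radial :
    IntegrableOn (fun p : ℝ × ℝ => p.2 * (1 - p.2 ^ 2 * normSqEdge p.1)⁻¹) unitSquare :=
  integrableOn_mul_poleKernel continuous_snd

theorem integral_logKernel :
    ∫ p in unitSquare, p.2 * (1 - p.2 ^ 2 * normSqEdge p.1)⁻¹ =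
      ∫ y in Ioo (0 : ℝ) 1, logKernel y := by
  have h := integrableOn_radial
  rw [unitSquare, Measure.volume_eq_prod] at h ⊢
  rw [setIntegral_prod _ h]
  exact setIntegral_congr_fun measurableSet_Ioo fun y hy => integral_radial hy

theorem integrableOn_logKernel : IntegrableOn logKernel (Ioo 0 1) := by
  have h := integrableOn_radial
  rw [unitSquare, Measure.volume_eq_prod, IntegrableOn, ← Measure.prod_restrict] at h
  exact IntegrableOn.congr_fun h.integral_prod_left (fun y hy => integral_radial hy)
    measurableSet_Ioo

/-- The symmetry y ↦ 1 - y of q folds the edge in half, so that the slope u = y/(1 - y) then ranges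
over the unit interval. -/
theorem integral_logKernel_eq_half :
    ∫ y in Ioo (0 : ℝ) 1, logKernel y = ∫ y in Ioo (0 : ℝ) (1 / 2), 2 * logKernel y := by
  have hi : IntervalIntegrable logKernel volume 0 1 :=
    (intervalIntegrable_iff_integrableOn_Ioo_of_le zero_le_one).2 integrableOn_logKernel
  have h1 : IntervalIntegrable logKernel volume 0 (1 / 2) :=
    hi.mono_set (by rw [uIcc_of_le (by norm_num), uIcc_of_le zero_le_one]
                    exact Icc_subset_Icc le_rfl (by norm_num))
  have h2 : IntervalIntegrable logKernel volume (1 / 2) 1 :=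
    hi.mono_set (by rw [uIcc_of_le (by norm_num), uIcc_of_le zero_le_one]
                    exact Icc_subset_Icc (by norm_num) le_rfl)
  have h3 : ∫ y in (1 / 2 : ℝ)..1, logKernel y = ∫ y in (0 : ℝ)..(1 / 2), logKernel y := by
    have h := intervalIntegral.integral_comp_sub_left (a := 0) (b := 1 / 2) logKernel 1
    rw [sub_zero, show (1 : ℝ) - 1 / 2 = 1 / 2 by norm_num] at h
    rw [← h]
    refine intervalIntegral.integral_congr fun y _ => ?_
    have : normSqEdge (1 - y) = normSqEdge y := by unfold normSqEdge; ring
    simp only [logKernel, this]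
  rw [integral_const_mul, ← integral_Ioc_eq_integral_Ioo, ← integral_Ioc_eq_integral_Ioo,
    ← intervalIntegral.integral_of_le zero_le_one,
    ← intervalIntegral.integral_of_le (by norm_num),
    ← intervalIntegral.integral_add_adjacent_intervals h1 h2, h3, two_mul]

/-- With y = u/(1 + u), 1 - q = 2u/(1 + u)² and q = (1 + u²)/(1 + u)². The logarithm splits into
-log u, which gives the Catalan constant, and the integrand of `integral_serret`, which contributes
0. -/
theorem integral_logKernel_half :
    ∫ y in Ioo (0 : ℝ) (1 / 2), 2 * logKernel y = catalanG := by
  have himg : (fun u : ℝ => u / (1 + u)) '' Ioo 0 1 = Ioo 0 (1 / 2) := by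
    ext y
    constructor
    · rintro ⟨u, ⟨h0, h1⟩, rfl⟩
      have : 0 < 1 + u := by linarith
      refine ⟨div_pos h0 this, ?_⟩
      simp only
      rw [div_lt_div_iff₀ this two_pos]
      linarith
    · rintro ⟨h0, h1⟩
      have : 0 < 1 - y := by linarith
      refine ⟨y / (1 - y), ⟨div_pos h0 this, (div_lt_one this).2 (by linarith)⟩, ?_⟩
      have h2 : 1 + y / (1 - y) = 1 / (1 - y) := by
        field_simp
        ring
      simp only [h2]
      field_simp
  have hinj : InjOn (fun u : ℝ => u / (1 + u)) (Ioo 0 1) := by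
    intro u hu v hv h
    have h1 : 1 + u ≠ 0 := by linarith [hu.1]
    have h2 : 1 + v ≠ 0 := by linarith [hv.1]
    simp only at h
    rw [div_eq_div_iff h1 h2] at h
    linarith
  have hder : ∀ u ∈ Ioo (0 : ℝ) 1, HasDerivWithinAt (fun u : ℝ => u / (1 + u))
      (1 / (1 + u) ^ 2) (Ioo 0 1) u := by
    intro u hu
    have h1 : 1 + u ≠ 0 := by linarith [hu.1]
    refine HasDerivAt.hasDerivWithinAt ?_
    refine ((hasDerivAt_id u).div ((hasDerivAt_id u).const_add 1) h1).congr_deriv ?_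
    simp only [id]
    congr 1
    ring
  have hsplit : catalanG = (∫ u in Ioo (0 : ℝ) 1, -Real.log u / (1 + u ^ 2)) +
      ∫ u in Ioo (0 : ℝ) 1, (2 * Real.log (1 + u) - Real.log 2) / (1 + u ^ 2) := by
    rw [integral_serret, add_zero, integral_neg_log_div_eq_catalanG]
  rw [← himg, integral_image_eq_integral_abs_deriv_smul measurableSet_Ioo hder hinj,
    hsplit, ← integral_add]
  · refine setIntegral_congr_fun measurableSet_Ioo fun u hu => ?_
    have hu0 : 0 < u := hu.1
    have h1 : 0 < 1 + u := by linarith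
    have e1 : 1 - normSqEdge (u / (1 + u)) = 2 * u / (1 + u) ^ 2 := by
      unfold normSqEdge
      field_simp
      ring
    have e2 : normSqEdge (u / (1 + u)) = (1 + u ^ 2) / (1 + u) ^ 2 := by
      unfold normSqEdge
      field_simp
      ring
    simp only [logKernel, e1]
    rw [e2, abs_of_pos (by positivity), Real.log_div (by positivity) (by positivity),
      Real.log_mul two_ne_zero hu0.ne', Real.log_pow]
    simp only [smul_eq_mul]
    field_simp
    push_cast
    ring
  · have h := intervalIntegral.intervalIntegrable_log' (a := 0) (b := 1)
    exact (intervalIntegrable_iff_integrableOn_Ioo_of_le zero_le_one).1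
      (by
        simp only [div_eq_mul_inv]
        refine h.neg.mul_continuousOn (Continuous.continuousOn ?_)
        exact Continuous.inv₀ (by fun_prop) fun u => by positivity)
  · refine IntegrableOn.mono_set (t := Icc 0 1) (ContinuousOn.integrableOn_Icc ?_)
      Ioo_subset_Icc_self
    refine ContinuousOn.div (ContinuousOn.sub (continuousOn_const.mul (ContinuousOn.log
      (by fun_prop) fun u hu => ?_)) continuousOn_const) (by fun_prop) fun u _ => by positivity
    linarith [hu.1]

theorem coneIntegral_zero_one : coneIntegral 0 (fun _ => 1) = catalanG := by
  rw [← integral_logKernel_half, ← integral_logKernel_eq_half, ← integral_logKernel, coneIntegral,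
    ← integral_complex_ofReal]
  simp

end CatalanIntegral

/-! ### Reduction to F_+, assembly of the two coefficients, and denominators. -/

section Assembly

open MeasureTheory Set

theorem swap_preimage_simplexΔ : Prod.swap ⁻¹' simplexΔ = simplexΔ := by
  ext ⟨x, y⟩
  change (0 ≤ y ∧ 0 ≤ x ∧ 0 ≤ 1 - y - x) ↔ (0 ≤ x ∧ 0 ≤ y ∧ 0 ≤ 1 - x - y)
  rw [sub_right_comm]
  tauto

/-- Invariance, read at the point (x, -y), is F(y, x) = F(x, -y); the denominator is symmetric. -/
theorem simplePoleFun_swap {F : MvPolynomial (Fin 2) ℤ} (hF : sigma F = F) (p : ℝ × ℝ) :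
    simplePoleFun F p.swap = simplePoleFun (conjY F) p := by
  have h1 : (MvPolynomial.aeval ![p.1, p.2]).comp conjY =
      (MvPolynomial.aeval ![p.1, -p.2] : MvPolynomial (Fin 2) ℤ →ₐ[ℤ] ℝ) := by
    ext i : 1
    fin_cases i <;> simp [conjY, scaleVars]
  have h2 : (MvPolynomial.aeval ![p.1, -p.2]).comp sigma =
      (MvPolynomial.aeval ![p.2, p.1] : MvPolynomial (Fin 2) ℤ →ₐ[ℤ] ℝ) := by
    ext i : 1
    fin_cases i <;> simp [sigma]
  have e1 := DFunLike.congr_fun h1 F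
  have e2 := DFunLike.congr_fun h2 F
  rw [AlgHom.comp_apply] at e1 e2
  rw [hF] at e2
  rw [simplePoleFun, simplePoleFun, e1, e2, Prod.fst_swap, Prod.snd_swap, sub_right_comm]

theorem setIntegral_simplePoleFun_evenPart {F : MvPolynomial (Fin 2) ℤ} (hF : sigma F = F) :
    ∫ p in simplexΔ, simplePoleFun F p = ∫ p in simplexΔ, simplePoleFun (evenPart F) p := by
  have h1 : ∫ p in simplexΔ, simplePoleFun (conjY F) p = ∫ p in simplexΔ, simplePoleFun F p := by
    have h := (Measure.measurePreserving_swap (μ := (volume : Measure ℝ))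
      (ν := (volume : Measure ℝ))).setIntegral_preimage_emb
      MeasurableEquiv.prodComm.measurableEmbedding (simplePoleFun F) simplexΔ
    rw [swap_preimage_simplexΔ] at h
    simp only [simplePoleFun_swap hF] at h
    exact h
  have h2 : ∀ p, 2 * simplePoleFun (evenPart F) p =
      simplePoleFun F p + simplePoleFun (conjY F) p := by
    intro p
    have h := congrArg (MvPolynomial.aeval ![p.1, p.2] : MvPolynomial (Fin 2) ℤ →ₐ[ℤ] ℝ)
      (two_mul_evenPart hF)
    rw [two_mul, map_add, map_add] at h
    rw [simplePoleFun, simplePoleFun, simplePoleFun, ← add_div, ← h]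
    ring
  have h3 : 2 * ∫ p in simplexΔ, simplePoleFun (evenPart F) p =
      2 * ∫ p in simplexΔ, simplePoleFun F p := by
    rw [← integral_const_mul]
    simp only [h2]
    rw [integral_add (integrableOn_simplePoleFun F) (integrableOn_simplePoleFun _), h1, two_mul]
  linarith

theorem setIntegral_simplePoleFun_eq_sum (F : MvPolynomial (Fin 2) ℤ) {N : ℕ}
    (hN : F.totalDegree ≤ N) :
    ((∫ p in simplexΔ, simplePoleFun F p : ℝ) : ℂ) =
      ∑ k ∈ Finset.range (N + 1), ∑ l ∈ Finset.range (N + 1),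
        zwCoeff F k l * coneIntegral (k + l) (zwEdge k l) := by
  have hi : ∀ k l : ℕ, IntegrableOn (fun p : ℝ × ℝ => zwCoeff F k l * (zwEdge k l p.1 *
      ((p.2 ^ (k + l + 1) * (1 - p.2 ^ 2 * normSqEdge p.1)⁻¹ : ℝ) : ℂ))) unitSquare := fun k l =>
    (integrableOn_coneIntegrand (k + l) (continuous_zwEdge k l)).const_mul _
  simp only [coneIntegral, ← integral_const_mul]
  rw [Finset.sum_congr rfl fun k _ => (integral_finsetSum (Finset.range (N + 1))
    fun l _ => hi k l).symm, ← integral_finsetSum _ fun k _ =>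
      integrable_finsetSum _ fun l _ => hi k l, setIntegral_simplexΔ, ← integral_complex_ofReal]
  refine setIntegral_congr_fun measurableSet_unitSquare fun p _ => ?_
  have h : 1 - (coneMap p).1 ^ 2 - (coneMap p).2 ^ 2 = 1 - p.2 ^ 2 * normSqEdge p.1 := by
    unfold coneMap normSqEdge
    ring
  simp only [simplePoleFun, smul_eq_mul, h, Complex.ofReal_mul, Complex.ofReal_div,
    aeval_eq_sum_zwCoeff F hN]
  rw [div_eq_mul_inv, Finset.sum_mul, Finset.mul_sum]
  refine Finset.sum_congr rfl fun k _ => ?_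
  rw [Finset.sum_mul, Finset.mul_sum]
  refine Finset.sum_congr rfl fun l _ => ?_
  simp only [coneMap, zwEdge]
  push_cast
  have e1 : (p.2 : ℂ) * (1 - p.1) + Complex.I * (p.2 * p.1) =
      p.2 * (1 - p.1 + Complex.I * p.1) := by ring
  have e2 : (p.2 : ℂ) * (1 - p.1) - Complex.I * (p.2 * p.1) =
      p.2 * (1 - p.1 - Complex.I * p.1) := by ring
  rw [e1, e2, mul_pow, mul_pow]
  ring

theorem sum_range_sum_range (n : ℕ) (a : ℕ → ℕ → ℂ) :
    ∑ k ∈ Finset.range n, ∑ l ∈ Finset.range n, a k l =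
      (∑ k ∈ Finset.range n, ∑ l ∈ Finset.range k, (a k l + a l k)) +
        ∑ k ∈ Finset.range n, a k k := by
  induction n with
  | zero => simp
  | succ n ih =>
    rw [Finset.sum_range_succ, Finset.sum_congr rfl fun k _ => Finset.sum_range_succ (a k) n,
      Finset.sum_add_distrib, ih, Finset.sum_range_succ (a n), Finset.sum_range_succ,
      Finset.sum_range_succ (fun k => a k k), Finset.sum_add_distrib]
    ring

theorem zwCoeff_evenPart_comm {F : MvPolynomial (Fin 2) ℤ} (hF : sigma F = F) (k l : ℕ) :
    zwCoeff (evenPart F) l k = zwCoeff (evenPart F) k l := by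
  have h1 := two_mul_zwCoeff_evenPart hF k l
  have h2 := two_mul_zwCoeff_evenPart hF l k
  linear_combination (h2 - h1) / 2

theorem zwCoeff_evenPart_self {F : MvPolynomial (Fin 2) ℤ} (hF : sigma F = F) (k : ℕ) :
    zwCoeff (evenPart F) k k = zwCoeff F k k := by
  have h1 := two_mul_zwCoeff_evenPart hF k k
  linear_combination h1 / 2

theorem zwCoeff_evenPart_eq_zero_of_not_modEq {F : MvPolynomial (Fin 2) ℤ} (hF : sigma F = F)
    {k l : ℕ} (h : ¬ k ≡ l [MOD 4]) : zwCoeff (evenPart F) k l = 0 := by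
  have h1 := two_mul_zwCoeff_evenPart hF k l
  rw [zwCoeff_eq_zero_of_not_modEq hF h, zwCoeff_eq_zero_of_not_modEq hF fun h' => h h'.symm] at h1
  linear_combination h1 / 2

theorem setIntegral_simplePoleFun {F : MvPolynomial (Fin 2) ℤ} (hF : sigma F = F) :
    ((∫ p in simplexΔ, simplePoleFun F p : ℝ) : ℂ) =
      coeffOfOne (evenPart F) F.totalDegree + (restrictToCircle F).coeff 0 * catalanG := by
  rw [setIntegral_simplePoleFun_evenPart hF,
    setIntegral_simplePoleFun_eq_sum _ (evenPart_totalDegree_le F), sum_range_sum_range,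
    coeffOfOne, coeff_restrictToCircle, add_assoc]
  congr 1
  · refine Finset.sum_congr rfl fun k _ => ?_
    rw [Finset.sum_filter]
    refine Finset.sum_congr rfl fun l hl => ?_
    split_ifs with h
    · rw [← coneIntegral_zwEdge_add (Finset.mem_range.1 hl) h, zwCoeff_evenPart_comm hF k l,
        add_comm l k]
      ring
    · rw [zwCoeff_evenPart_comm hF k l, zwCoeff_evenPart_eq_zero_of_not_modEq hF h]
      ring
  -- The index k = 0 may be added because `secondIntegral 0` is the integral of an empty sum.
  · have h0 : ∑ k ∈ Finset.Icc 1 F.totalDegree, zwCoeff (evenPart F) k k * (secondIntegral k : ℂ) =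
        ∑ k ∈ Finset.range (F.totalDegree + 1),
          zwCoeff (evenPart F) k k * (secondIntegral k : ℂ) := by
      refine Finset.sum_subset (fun k hk => ?_) fun k hk hk' => ?_
      · rw [Finset.mem_Icc] at hk
        rw [Finset.mem_range]
        omega
      · rw [Finset.mem_Icc] at hk'
        rw [Finset.mem_range] at hk
        obtain rfl : k = 0 := by omega
        simp [secondIntegral]
    rw [h0, Finset.sum_mul, ← Finset.sum_add_distrib]
    refine Finset.sum_congr rfl fun k _ => ?_
    rw [coneIntegral_zwEdge_self, coneIntegral_zero_one, zwCoeff_evenPart_self hF]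
    ring

theorem exists_rat_coeffOfOne (F : MvPolynomial (Fin 2) ℤ) :
    ∃ a : ℚ, (a : ℂ) = coeffOfOne (evenPart F) F.totalDegree ∧
      ∃ m : ℤ, (2 : ℚ) ^ (F.totalDegree + 3) * (lcmUpTo F.totalDegree : ℚ)
          * (lcmUpTo (F.totalDegree / 2) : ℚ) * a = m := by
  set N := F.totalDegree
  choose c hc using exists_int_two_pow_mul_zwCoeff_evenPart F
  have hcoeff : ∀ k l, zwCoeff (evenPart F) k l = (((c k l : ℚ) / 2 ^ N : ℚ) : ℂ) := by
    intro k l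
    push_cast
    rw [← hc, mul_div_cancel_left₀ _ (pow_ne_zero _ two_ne_zero)]
  have hzero : ∀ k l, N < k + l → c k l = 0 := by
    intro k l h
    have h1 := hc k l
    rw [zwCoeff_eq_zero_of_lt ((evenPart_totalDegree_le F).trans_lt h), mul_zero] at h1
    exact_mod_cast h1.symm
  -- The conditions sit inside the existential so that `choose` gives a function of k and l alone;
  -- its value elsewhere is irrelevant.
  have hr : ∀ k l : ℕ, ∃ r : ℚ, l < k → k ≡ l [MOD 4] → firstIntegral k l = r ∧
      (k + l ≤ N → ∃ m : ℤ, 8 * (lcmUpTo N : ℚ) * lcmUpTo (N / 2) * r = m) := by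
    intro k l
    by_cases h : l < k ∧ k ≡ l [MOD 4]
    · obtain ⟨r, h'⟩ := exists_rat_firstIntegral h.1 h.2
      exact ⟨r, fun _ _ => h'⟩
    · exact ⟨0, fun h1 h2 => absurd ⟨h1, h2⟩ h⟩
  choose r hr using hr
  -- The index sets also contain pairs with k + l > N. No denominator bound is available there, but
  -- the coefficient is 0 by `hzero`.
  choose s hs using fun k => exists_rat_secondIntegral k N
  have hint : ∀ k l (q : ℚ), (k + l ≤ N → ∃ m : ℤ,
      8 * (lcmUpTo N : ℚ) * lcmUpTo (N / 2) * q = m) →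
      (2 : ℚ) ^ (N + 3) * (lcmUpTo N : ℚ) * (lcmUpTo (N / 2) : ℚ) * ((c k l : ℚ) / 2 ^ N * q) ∈
        (Int.castRingHom ℚ).range := by
    intro k l q hq
    by_cases h : k + l ≤ N
    · obtain ⟨m, hm⟩ := hq h
      refine ⟨c k l * m, ?_⟩
      rw [eq_intCast]
      push_cast
      rw [← hm, pow_add]
      field_simp
      ring
    · rw [hzero k l (not_le.1 h)]
      simp
  refine ⟨(∑ k ∈ Finset.range (N + 1), ∑ l ∈ Finset.range k with k ≡ l [MOD 4],
    (c k l : ℚ) / 2 ^ N * r k l) + ∑ k ∈ Finset.Icc 1 N, (c k k : ℚ) / 2 ^ N * s k, ?_, ?_⟩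
  · rw [coeffOfOne, Rat.cast_add, Rat.cast_sum, Rat.cast_sum]
    congr 1
    · refine Finset.sum_congr rfl fun k _ => ?_
      rw [Rat.cast_sum]
      refine Finset.sum_congr rfl fun l hl => ?_
      rw [Finset.mem_filter, Finset.mem_range] at hl
      rw [Rat.cast_mul, ← hcoeff, (hr k l hl.1 hl.2).1]
    · refine Finset.sum_congr rfl fun k _ => ?_
      rw [Rat.cast_mul, ← hcoeff, (hs k).1, Complex.ofReal_ratCast]
  · suffices h : (2 : ℚ) ^ (N + 3) * (lcmUpTo N : ℚ) * (lcmUpTo (N / 2) : ℚ) *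
        ((∑ k ∈ Finset.range (N + 1), ∑ l ∈ Finset.range k with k ≡ l [MOD 4],
          (c k l : ℚ) / 2 ^ N * r k l) + ∑ k ∈ Finset.Icc 1 N, (c k k : ℚ) / 2 ^ N * s k) ∈
        (Int.castRingHom ℚ).range by
      obtain ⟨m, hm⟩ := h
      exact ⟨m, hm.symm⟩
    rw [mul_add, Finset.mul_sum, Finset.mul_sum]
    refine Subring.add_mem _ (Subring.sum_mem _ fun k _ => ?_) (Subring.sum_mem _ fun k _ => ?_)
    · rw [Finset.mul_sum]
      refine Subring.sum_mem _ fun l hl => ?_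
      rw [Finset.mem_filter, Finset.mem_range] at hl
      exact hint k l _ (hr k l hl.1 hl.2).2
    · exact hint k k _ (hs k).2

/-- F and F_+ have the same diagonal coefficients, so the denominator bound for F_+ applies to the
constant term of F. -/
theorem exists_rat_coeff_restrictToCircle {F : MvPolynomial (Fin 2) ℤ} (hF : sigma F = F) :
    ∃ b : ℚ, (b : ℂ) = (restrictToCircle F).coeff 0 ∧
      ∃ m : ℤ, (2 : ℚ) ^ F.totalDegree * b = m := by
  choose c hc using exists_int_two_pow_mul_zwCoeff_evenPart F
  have h2 : (2 : ℚ) ^ F.totalDegree ≠ 0 := pow_ne_zero _ two_ne_zero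
  refine ⟨(∑ k ∈ Finset.range (F.totalDegree + 1), c k k : ℤ) / 2 ^ F.totalDegree, ?_, _,
    mul_div_cancel₀ _ h2⟩
  rw [coeff_restrictToCircle]
  push_cast
  rw [div_eq_iff (pow_ne_zero _ two_ne_zero), Finset.sum_mul]
  refine Finset.sum_congr rfl fun k _ => ?_
  rw [← hc, zwCoeff_evenPart_self hF, mul_comm]

end Assembly

end CatalanForms

end

theorem mainTheorem2 (F : MvPolynomial (Fin 2) ℤ) (hF : CatalanForms.sigma F = F) :
    Even F.totalDegree ∧
    MeasureTheory.IntegrableOn (CatalanForms.simplePoleFun F) CatalanForms.simplexΔ ∧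
    (∀ k l : ℕ, l < k → k ≡ l [MOD 4] →
      ∃ p : Polynomial ℤ, p.natDegree < k + l ∧
        ∀ y : ℝ, 0 < y → y < 1 →
          CatalanForms.firstIntegrand k l y = Polynomial.aeval (y : ℂ) p) ∧
    ∃ a b : ℚ,
      ∫ p in CatalanForms.simplexΔ, CatalanForms.simplePoleFun F p
          = (a : ℝ) + (b : ℝ) * CatalanForms.catalanG ∧
      (∃ m : ℤ, (2 : ℚ) ^ F.totalDegree * b = m) ∧
      (∃ m : ℤ, (2 : ℚ) ^ (F.totalDegree + 3) * (CatalanForms.lcmUpTo F.totalDegree : ℚ)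
          * (CatalanForms.lcmUpTo (F.totalDegree / 2) : ℚ) * a = m) ∧
      (b : ℂ) = (CatalanForms.restrictToCircle F).coeff 0 ∧
      (a : ℂ) = CatalanForms.coeffOfOne (CatalanForms.evenPart F) F.totalDegree := by
  obtain ⟨a, ha, ha'⟩ := CatalanForms.exists_rat_coeffOfOne F
  obtain ⟨b, hb, hb'⟩ := CatalanForms.exists_rat_coeff_restrictToCircle hF
  refine ⟨CatalanForms.even_totalDegree hF, CatalanForms.integrableOn_simplePoleFun F,
    CatalanForms.exists_firstIntegrand_eq, a, b, ?_, hb', ha', hb, ha⟩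
  have h := CatalanForms.setIntegral_simplePoleFun hF
  rw [← ha, ← hb] at h
  exact_mod_cast h
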